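/- Let $n\ge 1$ be an integer and let $f,h:[0,1]^n\to\mathbb R$ be twice continuously differentiable. Write $\|\cdot\|$ for the supremum norm over $[0,1]^n$, $f_i=\partial f/\partial x_i$, $f_{ij}=\partial^2 f/\partial x_i\partial x_j$ (likewise for $h$), and put $$a=\|f\|,\quad b_i=\|f_i\|,\quad c_{ij}=\|f_{ij}\|,\qquad \alpha=\|h\|,\quad \beta_i=\|h_i\|,\quad \gamma_{ij}=\|h_{ij}\|.$$ For every $\epsilon>0$ let $\mathcal D_f(\epsilon)\subset\mathbb R^n$ be a finite set such that for every $x\in[0,1]^n$ there is $d\in\mathcal D_f(\epsilon)$ with $\sum_{i=1}^n(f_i(x)-d_i)^2\le n\epsilon^2$, and let $\mathcal D_h(\epsilon)$ be a finite set with the same property for $h$. Let $$I(x)=\sum_{i=1}^n\bigl(x_i\log x_i+(1-x_i)\log(1-x_i)\bigr)\qquad(0\log 0=0),$$ let $t>0$, and let $$F^c=\log\sum_{x\in\{0,1\}^n:\,|h(x)|\le tn}e^{f(x)},\qquad K=\log 2+\frac{2a}{n},$$ with the conventions $\log 0=-\infty$ for an empty sum in $F^c$, and $\sup\emptyset=-\infty$.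 **Upper bound.** For all $\delta>0$ and $\epsilon>0$, $$F^c\le \sup_{x\in[0,1]^n:\,|h(x)|\le(t+\delta)n}(f(x)-I(x))+\text{complexity term}+\text{smoothness term},$$ where $$\text{complexity term}=\frac14\Bigl(n\sum_{i=1}^n m_i^2\Bigr)^{1/2}\epsilon+3n\epsilon+\log\max\Bigl\{1,\ \frac{12K\bigl(\frac1n\sum_{i=1}^n\beta_i^2\bigr)^{1/2}}{\delta\epsilon}\Bigr\}+\log\bigl|\mathcal D_f(\epsilon/3)\bigr|+\log\bigl|\mathcal D_h(\delta\epsilon/(6K))\bigr|,$$ $$\text{smoothness term}=4\Bigl(\sum_{i=1}^n(l\,n_{ii}+m_i^2)+\frac14\sum_{i,j=1}^n(l\,n_{ij}^2+m_im_jn_{ij}+4m_in_{ij})\Bigr)^{1/2}+\frac14\Bigl(\sum_{i=1}^n m_i^2\Bigr)^{1/2}\Bigl(\sum_{i=1}^n n_{ii}^2\Bigr)^{1/2}+3\sum_{i=1}^n n_{ii}+\log 2,$$ and $$l=a+nK,\qquad m_i=b_i+\frac{2K\beta_i}{\delta},\qquad n_{ij}=c_{ij}+\frac{2K\gamma_{ij}}{\delta}+\frac{6K\beta_i\beta_j}{n\delta^2}.$$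 **Lower bound.** $$F^c\ge \sup_{x\in[0,1]^n:\,|h(x)|\le(t-\delta_0)n}(f(x)-I(x))-\epsilon_0n-\eta_0n-\log 2,$$ where $$\delta_0=\frac{\sqrt6}{n}\Bigl(\sum_{i=1}^n(\alpha\gamma_{ii}+\beta_i^2)\Bigr)^{1/2},\qquad \epsilon_0=2\sqrt{\frac6n},\qquad \eta_0=\frac{\sqrt6}{n}\Bigl(\sum_{i=1}^n(a\,c_{ii}+b_i^2)\Bigr)^{1/2}.$$ -/

import Mathlib

namespace CondNorm

/-- The unit cube `[0,1]^n`. -/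
def cube (n : ℕ) : Set (Fin n → ℝ) := Set.Icc 0 1

/-- The vertex set `{0,1}^n` of the unit cube. -/
noncomputable def vertices (n : ℕ) : Finset (Fin n → ℝ) :=
  Fintype.piFinset fun _ => ({0, 1} : Finset ℝ)

/-- Supremum norm over the unit cube of a function on it. -/
noncomputable def supNorm {n : ℕ} (f : (Fin n → ℝ) → ℝ) : ℝ := ⨆ x : cube n, |f x|

/-- The partial derivative `∂f/∂x_i` on the unit cube (one-sided at the boundary).
Only the values of `f` on the cube matter. -/
noncomputable def pd {n : ℕ} (i : Fin n) (f : (Fin n → ℝ) → ℝ) : (Fin n → ℝ) → ℝ :=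
  fun x => fderivWithin ℝ f (cube n) x (Pi.single i 1)

/-- `b_i = ‖∂f/∂x_i‖`. -/
noncomputable def norm₁ {n : ℕ} (f : (Fin n → ℝ) → ℝ) (i : Fin n) : ℝ := supNorm (pd i f)

/-- `c_ij = ‖∂²f/∂x_i∂x_j‖`. -/
noncomputable def norm₂ {n : ℕ} (f : (Fin n → ℝ) → ℝ) (i j : Fin n) : ℝ :=
  supNorm (pd i (pd j f))

/-- The low complexity gradient condition: for every `ε > 0`, the finite set `D ε` contains, for
each `x` in the cube, a vector `d` with `∑ (f_i(x) - d_i)² ≤ n ε²`. -/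
def IsGradientCover {n : ℕ} (f : (Fin n → ℝ) → ℝ) (D : ℝ → Finset (Fin n → ℝ)) : Prop :=
  ∀ ε : ℝ, 0 < ε → ∀ x ∈ cube n, ∃ d ∈ D ε, ∑ i, (pd i f x - d i) ^ 2 ≤ n * ε ^ 2

/-- `I(x) = ∑ (x_i log x_i + (1 - x_i) log (1 - x_i))`, with `0 log 0 = 0`. -/
noncomputable def entropyI {n : ℕ} (x : Fin n → ℝ) : ℝ :=
  ∑ i, (x i * Real.log (x i) + (1 - x i) * Real.log (1 - x i))

/-- `F^c = log ∑_{x ∈ {0,1}^n, |h(x)| ≤ t n} e^{f(x)}`, with `log 0 = -∞`. -/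
noncomputable def condLogSum {n : ℕ} (f h : (Fin n → ℝ) → ℝ) (t : ℝ) : EReal :=
  ENNReal.log (ENNReal.ofReal (∑ x ∈ vertices n with |h x| ≤ t * n, Real.exp (f x)))

/-- The supremum of `f - I` over `{x ∈ [0,1]^n : |h(x)| ≤ s n}`, with `sup ∅ = -∞`. -/
noncomputable def constrainedSup {n : ℕ} (f h : (Fin n → ℝ) → ℝ) (s : ℝ) : EReal :=
  ⨆ x ∈ {x ∈ cube n | |h x| ≤ s * n}, ((f x - entropyI x : ℝ) : EReal)

/-- `K = log 2 + 2a/n`. -/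
noncomputable def constK {n : ℕ} (f : (Fin n → ℝ) → ℝ) : ℝ := Real.log 2 + 2 * supNorm f / n

/-- `l = a + nK`. -/
noncomputable def constL {n : ℕ} (f : (Fin n → ℝ) → ℝ) : ℝ := supNorm f + n * constK f

/-- `m_i = b_i + 2Kβ_i/δ`. -/
noncomputable def constM {n : ℕ} (f h : (Fin n → ℝ) → ℝ) (δ : ℝ) (i : Fin n) : ℝ :=
  norm₁ f i + 2 * constK f * norm₁ h i / δ

/-- `n_ij = c_ij + 2Kγ_ij/δ + 6Kβ_iβ_j/(nδ²)`. -/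
noncomputable def constN {n : ℕ} (f h : (Fin n → ℝ) → ℝ) (δ : ℝ) (i j : Fin n) : ℝ :=
  norm₂ f i j + 2 * constK f * norm₂ h i j / δ
    + 6 * constK f * norm₁ h i * norm₁ h j / (n * δ ^ 2)

/-- The complexity term. -/
noncomputable def complexityTerm {n : ℕ} (f h : (Fin n → ℝ) → ℝ)
    (Df Dh : ℝ → Finset (Fin n → ℝ)) (δ ε : ℝ) : ℝ :=
  1 / 4 * √(n * ∑ i, constM f h δ i ^ 2) * ε + 3 * n * ε
    + Real.log (max 1 (12 * constK f * √(1 / n * ∑ i, norm₁ h i ^ 2) / (δ * ε)))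
    + Real.log (Df (ε / 3)).card
    + Real.log (Dh (δ * ε / (6 * constK f))).card

/-- The smoothness term. -/
noncomputable def smoothnessTerm {n : ℕ} (f h : (Fin n → ℝ) → ℝ) (δ : ℝ) : ℝ :=
  4 * √(∑ i, (constL f * constN f h δ i i + constM f h δ i ^ 2)
      + 1 / 4 * ∑ i, ∑ j, (constL f * constN f h δ i j ^ 2
          + constM f h δ i * constM f h δ j * constN f h δ i j
          + 4 * constM f h δ i * constN f h δ i j))
    + 1 / 4 * √(∑ i, constM f h δ i ^ 2) * √(∑ i, constN f h δ i i ^ 2)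
    + 3 * ∑ i, constN f h δ i i + Real.log 2

/-- `(√6/n) (∑ (‖f‖ ‖f_ii‖ + ‖f_i‖²))^{1/2}`: this is `η₀` for `f`, and `δ₀` for `h`. -/
noncomputable def deviation {n : ℕ} (f : (Fin n → ℝ) → ℝ) : ℝ :=
  √6 / n * √(∑ i, (supNorm f * norm₂ f i i + norm₁ f i ^ 2))

end CondNorm

namespace CondNorm

/-! ### One-variable estimates -/

/-! Upper bound. The constraint is replaced by a penalty: let `φ = f - nK ψ(h)`, where `ψ` vanishes
for `|h| ≤ tn` and equals `1` for `|h| ≥ (t+δ)n`. Then `F^c ≤ log ∑ e^φ`, and `K` is large enough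
that points with `|h| ≥ (t+δ)n` contribute at most `-a` to `sup (φ - I)`. A cover for the gradient
of `φ` is built from those of `f` and `h` and a grid for the scalar factor `-nK ψ'(h)`
(`exists_cover_add_mul`).

The partition function of `φ` is bounded in `log_sum_exp_le`. Each `x` is coded by a vector `d(x)`
near the gradient at `x`, taken from the cover `D`. The product Bernoulli laws with natural
parameters in `D` have total mass `|D|`, so Jensen gives `log Z ≤ E[φ(x) - log-likelihood of x under
d(x)] + log |D|`, with `E` the Gibbs mean (`log_sum_exp_le_of_code`). With `p = sigmoid(d(x))` and
`x̂` the vector of conditional means of the coordinates, the bracket splits into `φ(x) - φ(x̂)`,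
`φ(x̂) - φ(p)`, `φ(p) - I(p)` and an entropy difference. The second is small because the discrete
derivatives of `φ` are near `d(x)`; the third is at most the supremum. The first and last are
controlled in mean by resampling one coordinate: `E[(xᵢ - x̂ᵢ) w(x)]` sees only the change of `w`
when `xᵢ` is flipped (`abs_sum_weight_sub_mul_le`). First moments suffice.

Lower bound. For feasible `y`, tilt to the product law with means `y`. The same resampling estimate
bounds the second moments of `f(x) - f(y)`, `h(x) - h(y)` and the centred log-likelihood. By
Chebyshev each is large with probability at most `1/6`, so all three are small with probability at
least `1/2`, and changing measure on that event gives the bound (`half_exp_le_sum_exp`). -/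

theorem abs_sub_le_of_hasDerivAt {G G' : ℝ → ℝ} {M : ℝ} (hG : ∀ x, HasDerivAt G (G' x) x)
    (hM : ∀ x, |G' x| ≤ M) (x y : ℝ) : |G x - G y| ≤ M * |x - y| := by
  have := Convex.norm_image_sub_le_of_norm_hasDerivWithin_le (f := G) (f' := G') (s := Set.univ)
    (C := M) (x := y) (y := x) (fun z _ => (hG z).hasDerivWithinAt) (fun z _ => hM z)
    convex_univ (Set.mem_univ _) (Set.mem_univ _)
  simpa [Real.norm_eq_abs] using this

theorem abs_sub_le_of_hasDerivWithinAt_unitInterval {G G' : ℝ → ℝ} {M : ℝ}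
    (hG : ∀ s ∈ Set.Icc (0 : ℝ) 1, HasDerivWithinAt G (G' s) (Set.Icc 0 1) s)
    (hM : ∀ s ∈ Set.Icc (0 : ℝ) 1, |G' s| ≤ M) : |G 1 - G 0| ≤ M := by
  have := Convex.norm_image_sub_le_of_norm_hasDerivWithin_le (f := G) (f' := G')
    (C := M) (x := 0) (y := 1) hG hM (convex_Icc 0 1) (by simp) (by simp)
  simpa [Real.norm_eq_abs] using this

theorem mul_one_sub_le_quarter (p : ℝ) : p * (1 - p) ≤ 1 / 4 := by
  nlinarith [sq_nonneg (p - 1 / 2)]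

theorem abs_sigmoid_sub_le (u v : ℝ) :
    |Real.sigmoid u - Real.sigmoid v| ≤ 1 / 4 * |u - v| := by
  refine abs_sub_le_of_hasDerivAt Real.hasDerivAt_sigmoid (fun x => ?_) u v
  have h0 := Real.sigmoid_nonneg x
  have h1 := Real.sigmoid_le_one x
  rw [abs_of_nonneg (mul_nonneg h0 (sub_nonneg.2 h1))]
  exact mul_one_sub_le_quarter _

/-- The log-partition function of a Bernoulli variable with natural parameter `u`. -/
noncomputable def logOneAddExp (u : ℝ) : ℝ := Real.log (1 + Real.exp u)

theorem hasDerivAt_logOneAddExp (u : ℝ) : HasDerivAt logOneAddExp (Real.sigmoid u) u := by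
  have h := ((Real.hasDerivAt_exp u).const_add 1).log (by positivity)
  convert! h using 1
  rw [Real.sigmoid_def, Real.exp_neg]
  have := Real.exp_pos u
  field_simp
  ring

theorem one_sub_sigmoid (u : ℝ) : 1 - Real.sigmoid u = (1 + Real.exp u)⁻¹ := by
  rw [← Real.sigmoid_neg, Real.sigmoid_def, neg_neg]

theorem log_one_sub_sigmoid (u : ℝ) : Real.log (1 - Real.sigmoid u) = -logOneAddExp u := by
  rw [one_sub_sigmoid, Real.log_inv, logOneAddExp]

theorem log_sigmoid (u : ℝ) : Real.log (Real.sigmoid u) = u - logOneAddExp u := by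
  have : Real.sigmoid u = Real.exp u * (1 + Real.exp u)⁻¹ := by
    rw [Real.sigmoid_def, Real.exp_neg]
    have := Real.exp_pos u
    field_simp
    ring
  rw [this, Real.log_mul (Real.exp_pos u).ne' (by positivity), Real.log_exp, Real.log_inv,
    logOneAddExp, sub_eq_add_neg]

/-- For `u ≥ 0` one has `u (1 - sigmoid u) = u / (1 + e^u) ≤ 1`; the expression is odd in `u`. -/
theorem abs_mul_sigmoid_le_one (u : ℝ) :
    |u * (Real.sigmoid u * (1 - Real.sigmoid u))| ≤ 1 := by
  have key : ∀ v : ℝ, 0 ≤ v → v * (Real.sigmoid v * (1 - Real.sigmoid v)) ≤ 1 := by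
    intro v hv
    have h0 := Real.sigmoid_nonneg v
    have h1 := Real.sigmoid_le_one v
    have h2 : v * (1 - Real.sigmoid v) ≤ 1 := by
      rw [one_sub_sigmoid, ← div_eq_mul_inv, div_le_one (by positivity)]
      linarith [Real.add_one_le_exp v]
    have h3 : 0 ≤ v * (1 - Real.sigmoid v) := mul_nonneg hv (by linarith)
    nlinarith
  have h0 := Real.sigmoid_nonneg u
  have h1 := Real.sigmoid_le_one u
  have hp : 0 ≤ Real.sigmoid u * (1 - Real.sigmoid u) := mul_nonneg h0 (by linarith)
  rcases le_total 0 u with hu | hu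
  · rw [abs_of_nonneg (mul_nonneg hu hp)]
    exact key u hu
  · have := key (-u) (by linarith)
    rw [Real.sigmoid_neg] at this
    rw [abs_of_nonpos (mul_nonpos_of_nonpos_of_nonneg hu hp)]
    linarith

theorem abs_bernoulliLogLikelihood_sub_le {x : ℝ} (hx : x = 0 ∨ x = 1) (u v : ℝ) :
    |(x * u - logOneAddExp u) - (x * v - logOneAddExp v)| ≤ |u - v| := by
  have := abs_sub_le_of_hasDerivAt (G := fun u => x * u - logOneAddExp u)
    (G' := fun u => x * 1 - Real.sigmoid u) (M := 1)
    (fun z => ((hasDerivAt_id z).const_mul x).sub (hasDerivAt_logOneAddExp z)) (fun z => by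
      have h0 := Real.sigmoid_nonneg z
      have h1 := Real.sigmoid_le_one z
      rw [abs_le]
      rcases hx with rfl | rfl <;> constructor <;> linarith) u v
  simpa using this

/-- The derivative is `u σ(u) (1 - σ(u))`. Although `u` is unbounded, the entropy is thus
1-Lipschitz in the natural parameter. -/
theorem abs_bernoulliEntropy_sub_le (u v : ℝ) :
    |(Real.sigmoid u * u - logOneAddExp u) - (Real.sigmoid v * v - logOneAddExp v)| ≤ |u - v| := by
  have := abs_sub_le_of_hasDerivAt (G := fun u => Real.sigmoid u * u - logOneAddExp u)
    (G' := fun u => Real.sigmoid u * (1 - Real.sigmoid u) * u + Real.sigmoid u * 1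
      - Real.sigmoid u) (M := 1)
    (fun z => ((Real.hasDerivAt_sigmoid z).mul (hasDerivAt_id z)).sub
      (hasDerivAt_logOneAddExp z)) (fun z => by
      have := abs_mul_sigmoid_le_one z
      rwa [mul_one, add_sub_cancel_right, mul_comm]) u v
  simpa using this

/-- Both logarithms are nonpositive, so their difference is dominated by the larger one, and `z log²
z ≤ 4` follows from `|√z log √z| < 1`. The bound stays uniform up to the boundary, where the
log-odds blow up. -/
theorem mul_one_sub_mul_sq_log_sub_le {y : ℝ} (h0 : 0 ≤ y) (h1 : y ≤ 1) :
    y * (1 - y) * (Real.log y - Real.log (1 - y)) ^ 2 ≤ 4 := by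
  have key : ∀ z : ℝ, 0 ≤ z → z ≤ 1 → z * Real.log z ^ 2 ≤ 4 := by
    intro z hz0 hz1
    rcases hz0.eq_or_lt with rfl | hz
    · simp
    have hs : 0 < √z := Real.sqrt_pos.2 hz
    have hs1 : √z ≤ 1 := Real.sqrt_le_one.2 hz1
    have hlt := (Real.abs_log_mul_self_lt (√z) hs hs1).le
    have hlog : Real.log z = 2 * Real.log (√z) := by
      rw [Real.log_sqrt hz0]; ring
    have hsq : (Real.log (√z) * √z) ^ 2 ≤ 1 := (sq_le_one_iff_abs_le_one _).2 hlt
    rw [mul_pow, Real.sq_sqrt hz0] at hsq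
    rw [hlog]
    nlinarith
  have hy := key y h0 h1
  have hy' := key (1 - y) (by linarith) (by linarith)
  have l0 := Real.log_nonpos h0 h1
  have l1 := Real.log_nonpos (x := 1 - y) (by linarith) (by linarith)
  set A := Real.log y
  set B := Real.log (1 - y)
  rcases le_total A B with hAB | hAB
  · have h2 : (A - B) ^ 2 ≤ A ^ 2 := by nlinarith
    have h3 : 0 ≤ y * A ^ 2 := by positivity
    nlinarith [mul_le_mul_of_nonneg_left h2 (mul_nonneg h0 (sub_nonneg.2 h1))]
  · have h2 : (A - B) ^ 2 ≤ B ^ 2 := by nlinarith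
    have h3 : 0 ≤ (1 - y) * B ^ 2 := mul_nonneg (by linarith) (sq_nonneg _)
    nlinarith [mul_le_mul_of_nonneg_left h2 (mul_nonneg h0 (sub_nonneg.2 h1))]

theorem neg_log_two_le_mul_log_add_mul_log (y : ℝ) :
    -Real.log 2 ≤ y * Real.log y + (1 - y) * Real.log (1 - y) := by
  have h := Real.binEntropy_le_log_two (p := y)
  rw [Real.binEntropy] at h
  simp only [Real.log_inv] at h
  linarith

/-! ### The cube and its vertices -/

variable {n : ℕ}

theorem mem_cube {x : Fin n → ℝ} : x ∈ cube n ↔ ∀ i, 0 ≤ x i ∧ x i ≤ 1 := by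
  simp [cube, Set.mem_Icc, Pi.le_def, forall_and]

theorem mem_vertices {x : Fin n → ℝ} : x ∈ vertices n ↔ ∀ i, x i = 0 ∨ x i = 1 := by
  simp [vertices]

theorem vertices_subset_cube {x : Fin n → ℝ} (hx : x ∈ vertices n) : x ∈ cube n :=
  mem_cube.2 fun i => by rcases mem_vertices.1 hx i with h | h <;> simp [h]

theorem convex_cube : Convex ℝ (cube n) := convex_Icc _ _

theorem vertices_nonempty : (vertices n).Nonempty := ⟨0, mem_vertices.2 fun _ => Or.inl rfl⟩

theorem update_mem_cube {x : Fin n → ℝ} (hx : x ∈ cube n) (i : Fin n) {s : ℝ} (h0 : 0 ≤ s)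
    (h1 : s ≤ 1) : Function.update x i s ∈ cube n := by
  refine mem_cube.2 fun j => ?_
  rcases eq_or_ne j i with rfl | hj
  · simp [h0, h1]
  · simpa [hj] using mem_cube.1 hx j

theorem lineMap_mem_cube {x y : Fin n → ℝ} (hx : x ∈ cube n) (hy : y ∈ cube n) {s : ℝ}
    (hs : s ∈ Set.Icc (0 : ℝ) 1) : y + s • (x - y) ∈ cube n :=
  convex_cube.add_smul_sub_mem hy hx hs

theorem sum_vertices_prod (q : Fin n → ℝ → ℝ) :
    ∑ x ∈ vertices n, ∏ i, q i (x i) = ∏ i, (q i 0 + q i 1) := by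
  rw [vertices, ← Finset.prod_univ_sum]
  simp

/-- `φ'` is the vector of partial derivatives of `φ` on the cube. -/
def HasGradient (φ : (Fin n → ℝ) → ℝ) (φ' : Fin n → (Fin n → ℝ) → ℝ) : Prop :=
  ∀ x ∈ cube n, HasFDerivWithinAt φ
    (∑ i, φ' i x • ContinuousLinearMap.proj (R := ℝ) (φ := fun _ : Fin n => ℝ) i) (cube n) x

/-- The function `φ` has modulus of continuity `∑ bᵢ |xᵢ - yᵢ|` on the cube. -/
def CoordLipschitz (b : Fin n → ℝ) (φ : (Fin n → ℝ) → ℝ) : Prop :=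
  ∀ x ∈ cube n, ∀ y ∈ cube n, |φ x - φ y| ≤ ∑ i, b i * |x i - y i|

theorem HasGradient.hasDerivWithinAt_line {φ : (Fin n → ℝ) → ℝ} {φ' : Fin n → (Fin n → ℝ) → ℝ}
    (h : HasGradient φ φ') {x y : Fin n → ℝ} (hx : x ∈ cube n) (hy : y ∈ cube n) {s : ℝ}
    (hs : s ∈ Set.Icc (0 : ℝ) 1) :
    HasDerivWithinAt (fun s : ℝ => φ (y + s • (x - y)))
      (∑ i, (x i - y i) * φ' i (y + s • (x - y))) (Set.Icc 0 1) s := by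
  have h1 : HasDerivWithinAt (fun s : ℝ => y + s • (x - y)) (x - y) (Set.Icc 0 1) s := by
    have := ((hasDerivAt_id s).smul_const (x - y)).const_add y
    simpa using! this.hasDerivWithinAt
  have h2 := (h _ (lineMap_mem_cube hx hy hs)).comp_hasDerivWithinAt s h1
    (fun r hr => lineMap_mem_cube hx hy hr)
  convert! h2 using 1
  simp [mul_comm]

theorem HasGradient.coordLipschitz {φ : (Fin n → ℝ) → ℝ} {φ' : Fin n → (Fin n → ℝ) → ℝ}
    (h : HasGradient φ φ') {b : Fin n → ℝ} (hb : ∀ i, ∀ x ∈ cube n, |φ' i x| ≤ b i) :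
    CoordLipschitz b φ := by
  intro x hx y hy
  have := abs_sub_le_of_hasDerivWithinAt_unitInterval
    (G := fun s : ℝ => φ (y + s • (x - y))) (M := ∑ i, b i * |x i - y i|)
    (fun s hs => h.hasDerivWithinAt_line hx hy hs) (fun s hs => by
      refine (Finset.abs_sum_le_sum_abs _ _).trans (Finset.sum_le_sum fun i _ => ?_)
      rw [abs_mul, mul_comm]
      exact mul_le_mul_of_nonneg_right (hb i _ (lineMap_mem_cube hx hy hs)) (abs_nonneg _))
  simpa using this

theorem CoordLipschitz.abs_sub_le_of_eq_off {b : Fin n → ℝ} {φ : (Fin n → ℝ) → ℝ}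
    (h : CoordLipschitz b φ) {x y : Fin n → ℝ} (hx : x ∈ cube n) (hy : y ∈ cube n) (i : Fin n)
    (hxy : ∀ j, j ≠ i → x j = y j) : |φ x - φ y| ≤ b i * |x i - y i| := by
  refine (h x hx y hy).trans_eq ?_
  refine Finset.sum_eq_single i (fun j _ hj => ?_) (by simp)
  simp [hxy j hj]

/-! ### Resampling one coordinate -/

theorem update_mem_vertices {x : Fin n → ℝ} (hx : x ∈ vertices n) (i : Fin n) {s : ℝ}
    (hs : s = 0 ∨ s = 1) : Function.update x i s ∈ vertices n := by
  refine mem_vertices.2 fun j => ?_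
  rcases eq_or_ne j i with rfl | hj
  · simpa using hs
  · simpa [hj] using mem_vertices.1 hx j

theorem sum_vertices_flip (i : Fin n) (G : (Fin n → ℝ) → ℝ) :
    ∑ x ∈ vertices n, G (Function.update x i (1 - x i)) = ∑ x ∈ vertices n, G x := by
  have hmem : ∀ x ∈ vertices n, Function.update x i (1 - x i) ∈ vertices n := fun x hx =>
    update_mem_vertices hx i (by rcases mem_vertices.1 hx i with h | h <;> simp [h])
  refine Finset.sum_nbij' (fun x => Function.update x i (1 - x i))
    (fun x => Function.update x i (1 - x i)) hmem hmem ?_ ?_ (fun _ _ => rfl) <;>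
  · intro x _
    simp

/-- If, given the other coordinates, the `i`-th coordinate is `1` with probability `p` under the
weight `W`, then the mean of `(xᵢ - p) w` is controlled by the influence of `xᵢ` on `w`. -/
theorem abs_sum_weight_sub_mul_le {W p w : (Fin n → ℝ) → ℝ} {M : ℝ} (i : Fin n)
    (hW : ∀ x ∈ vertices n, 0 ≤ W x)
    (hp : ∀ x ∈ vertices n, ∀ s, p (Function.update x i s) = p x)
    (hWp : ∀ x ∈ vertices n, W (Function.update x i 1)
      = p x * (W (Function.update x i 0) + W (Function.update x i 1)))
    (hM : ∀ x ∈ vertices n,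
      |p x * (1 - p x) * (w (Function.update x i 1) - w (Function.update x i 0))| ≤ M) :
    |∑ x ∈ vertices n, W x * ((x i - p x) * w x)| ≤ M * ∑ x ∈ vertices n, W x := by
  set G : (Fin n → ℝ) → ℝ := fun x => W x * ((x i - p x) * w x) with hG
  have hpair : ∀ x ∈ vertices n, |G x + G (Function.update x i (1 - x i))|
      ≤ M * (W x + W (Function.update x i (1 - x i))) := by
    intro x hx
    have hmain : |G (Function.update x i 0) + G (Function.update x i 1)|
        ≤ M * (W (Function.update x i 0) + W (Function.update x i 1)) := by
      have h0 := hW _ (update_mem_vertices hx i (Or.inl rfl))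
      have h1 := hW _ (update_mem_vertices hx i (Or.inr rfl))
      have e := hWp x hx
      have hm := hM x hx
      simp only [hG, hp x hx, Function.update_self]
      set W0 := W (Function.update x i 0)
      set W1 := W (Function.update x i 1)
      have e0 : W0 = (1 - p x) * (W0 + W1) := by linarith
      -- A Bernoulli variable of mean `p` satisfies `E[(ξ - p) w(ξ)] = p (1 - p) (w(1) - w(0))`.
      have : W0 * ((0 - p x) * w (Function.update x i 0))
          + W1 * ((1 - p x) * w (Function.update x i 1))
          = (p x * (1 - p x) * (w (Function.update x i 1) - w (Function.update x i 0)))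
            * (W0 + W1) := by
        calc _ = ((1 - p x) * (W0 + W1)) * ((0 - p x) * w (Function.update x i 0))
          + (p x * (W0 + W1)) * ((1 - p x) * w (Function.update x i 1)) := by rw [← e0, ← e]
          _ = _ := by ring
      rw [this, abs_mul, abs_of_nonneg (add_nonneg h0 h1)]
      exact mul_le_mul_of_nonneg_right hm (add_nonneg h0 h1)
    rcases mem_vertices.1 hx i with h | h
    · have e : Function.update x i 0 = x := by rw [← h, Function.update_eq_self]
      rw [e] at hmain
      simpa [h] using hmain
    · have e : Function.update x i 1 = x := by rw [← h, Function.update_eq_self]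
      rw [e] at hmain
      rw [add_comm, add_comm (W x)]
      simpa [h] using hmain
  -- Flipping the coordinate is an involution of the vertices, so pairing each vertex with its flip
  -- counts the sum twice.
  have h2 : 2 * ∑ x ∈ vertices n, G x
      = ∑ x ∈ vertices n, (G x + G (Function.update x i (1 - x i))) := by
    rw [Finset.sum_add_distrib, sum_vertices_flip]; ring
  have h3 : 2 * ∑ x ∈ vertices n, W x
      = ∑ x ∈ vertices n, (W x + W (Function.update x i (1 - x i))) := by
    rw [Finset.sum_add_distrib, sum_vertices_flip]; ring
  have h4 : |2 * ∑ x ∈ vertices n, G x| ≤ M * (2 * ∑ x ∈ vertices n, W x) := by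
    rw [h2, h3, Finset.mul_sum]
    exact (Finset.abs_sum_le_sum_abs _ _).trans (Finset.sum_le_sum hpair)
  rw [abs_mul, abs_of_pos (by norm_num : (0 : ℝ) < 2)] at h4
  linarith


/-- Interpolating from `q x` to `x`, the derivative is a sum of terms with the conditionally centred
factor `xᵢ - qᵢ`, to which the resampling estimate applies; the `1/4` bounds `qᵢ (1 - qᵢ)`. The
upper bound uses Gibbs weights with `v = 1` and `q` the conditional means; the lower bound uses
product weights with `q = y` and `v = f - f(y)`. -/
theorem abs_sum_weight_mul_sub_le {φ : (Fin n → ℝ) → ℝ} {φ' : Fin n → (Fin n → ℝ) → ℝ}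
    (hφ : HasGradient φ φ') {W v : (Fin n → ℝ) → ℝ} {q : (Fin n → ℝ) → Fin n → ℝ}
    {M : Fin n → ℝ} (hW : ∀ x ∈ vertices n, 0 ≤ W x) (hq : ∀ x ∈ vertices n, q x ∈ cube n)
    (hqi : ∀ x ∈ vertices n, ∀ i s, q (Function.update x i s) i = q x i)
    (hWq : ∀ x ∈ vertices n, ∀ i, W (Function.update x i 1)
      = q x i * (W (Function.update x i 0) + W (Function.update x i 1)))
    (hM : ∀ s ∈ Set.Icc (0 : ℝ) 1, ∀ i, ∀ x₀ ∈ vertices n, ∀ x₁ ∈ vertices n,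
      (∀ j, j ≠ i → x₁ j = x₀ j) →
      |v x₁ * φ' i (q x₁ + s • (x₁ - q x₁)) - v x₀ * φ' i (q x₀ + s • (x₀ - q x₀))| ≤ M i) :
    |∑ x ∈ vertices n, W x * (v x * (φ x - φ (q x)))|
      ≤ 1 / 4 * (∑ i, M i) * ∑ x ∈ vertices n, W x := by
  have key := abs_sub_le_of_hasDerivWithinAt_unitInterval
    (G := fun s : ℝ => ∑ x ∈ vertices n, W x * (v x * φ (q x + s • (x - q x))))
    (G' := fun s : ℝ => ∑ x ∈ vertices n,
      W x * (v x * ∑ i, (x i - q x i) * φ' i (q x + s • (x - q x))))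
    (M := 1 / 4 * (∑ i, M i) * ∑ x ∈ vertices n, W x)
    (fun s hs => HasDerivWithinAt.fun_sum fun x hx =>
      ((hφ.hasDerivWithinAt_line (vertices_subset_cube hx) (hq x hx) hs).const_mul _).const_mul _)
    (fun s hs => by
      have e : ∑ x ∈ vertices n, W x * (v x * ∑ i, (x i - q x i) * φ' i (q x + s • (x - q x)))
          = ∑ i, ∑ x ∈ vertices n,
            W x * ((x i - q x i) * (v x * φ' i (q x + s • (x - q x)))) := by
        rw [Finset.sum_comm]
        refine Finset.sum_congr rfl fun x _ => ?_
        rw [Finset.mul_sum, Finset.mul_sum]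
        exact Finset.sum_congr rfl fun i _ => by ring
      rw [e, Finset.mul_sum Finset.univ M, Finset.sum_mul]
      refine (Finset.abs_sum_le_sum_abs _ _).trans (Finset.sum_le_sum fun i _ => ?_)
      refine abs_sum_weight_sub_mul_le (p := fun x => q x i)
        (w := fun x => v x * φ' i (q x + s • (x - q x))) i hW (fun x hx s => hqi x hx i s)
        (fun x hx => hWq x hx i) (fun x hx => ?_)
      have hqx := mem_cube.1 (hq x hx) i
      rw [abs_mul, abs_of_nonneg (mul_nonneg hqx.1 (sub_nonneg.2 hqx.2))]
      have hMi := hM s hs i _ (update_mem_vertices hx i (Or.inl rfl)) _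
        (update_mem_vertices hx i (Or.inr rfl)) (fun j hj => by simp [hj])
      exact mul_le_mul (mul_one_sub_le_quarter _) hMi (abs_nonneg _) (by norm_num))
  have e : ∀ x : Fin n → ℝ, q x + (x - q x) = x := fun x => by abel
  simpa [e, ← Finset.sum_sub_distrib, ← mul_sub] using key

/-- The difference of `φ` between the two values of the `i`-th coordinate. -/
noncomputable def discreteDeriv (φ : (Fin n → ℝ) → ℝ) (x : Fin n → ℝ) (i : Fin n) : ℝ :=
  φ (Function.update x i 1) - φ (Function.update x i 0)

theorem discreteDeriv_update (φ : (Fin n → ℝ) → ℝ) (x : Fin n → ℝ) (i : Fin n) (s : ℝ) :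
    discreteDeriv φ (Function.update x i s) i = discreteDeriv φ x i := by
  simp [discreteDeriv]

theorem HasGradient.hasDerivWithinAt_update {φ : (Fin n → ℝ) → ℝ}
    {φ' : Fin n → (Fin n → ℝ) → ℝ} (h : HasGradient φ φ') {x : Fin n → ℝ} (hx : x ∈ cube n)
    (i : Fin n) {s : ℝ} (hs : s ∈ Set.Icc (0 : ℝ) 1) :
    HasDerivWithinAt (fun s : ℝ => φ (Function.update x i s)) (φ' i (Function.update x i s))
      (Set.Icc 0 1) s := by
  have h0 := update_mem_cube hx i le_rfl zero_le_one
  have h1 := update_mem_cube hx i zero_le_one le_rfl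
  have e : ∀ s : ℝ, Function.update x i 0 + s • (Function.update x i 1 - Function.update x i 0)
      = Function.update x i s := by
    intro s
    funext j
    rcases eq_or_ne j i with rfl | hj <;> simp [*]
  have := h.hasDerivWithinAt_line h1 h0 hs
  simp only [e] at this
  convert! this using 1
  rw [Finset.sum_eq_single i (fun j _ hj => by simp [hj]) (by simp)]
  simp

/-! ### Discrete derivatives and conditional means under the Gibbs weight -/

section Smooth

variable {φ : (Fin n → ℝ) → ℝ} {φ' : Fin n → (Fin n → ℝ) → ℝ} {c : Fin n → Fin n → ℝ}

theorem abs_discreteDeriv_sub_gradient_le (hφ : HasGradient φ φ')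
    (hc : ∀ j, CoordLipschitz (fun i => c i j) (φ' j)) (hc0 : ∀ i j, 0 ≤ c i j) {x : Fin n → ℝ}
    (hx : x ∈ cube n) (i : Fin n) : |discreteDeriv φ x i - φ' i x| ≤ c i i := by
  have := abs_sub_le_of_hasDerivWithinAt_unitInterval
    (G := fun s : ℝ => φ (Function.update x i s) - s * φ' i x) (M := c i i)
    (fun s hs => (hφ.hasDerivWithinAt_update hx i hs).sub
      (((hasDerivAt_id s).mul_const _).hasDerivWithinAt)) (fun s hs => by
      rw [one_mul]
      refine ((hc i).abs_sub_le_of_eq_off (update_mem_cube hx i hs.1 hs.2) hx i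
        (fun j hj => by simp [hj])).trans ?_
      refine mul_le_of_le_one_right (hc0 i i) ?_
      have := mem_cube.1 hx i
      rw [Function.update_self, abs_le]
      constructor <;> linarith [hs.1, hs.2])
  convert! this using 2
  simp [discreteDeriv]
  ring

/-- Integrating the change of `φ' j` along the `j`-th edge uses only that the gradient is Lipschitz.
This matters because the penalty is not twice differentiable. -/
theorem abs_discreteDeriv_sub_le (hφ : HasGradient φ φ')
    (hc : ∀ j, CoordLipschitz (fun i => c i j) (φ' j)) (hc0 : ∀ i j, 0 ≤ c i j)
    {x₀ x₁ : Fin n → ℝ} (h₀ : x₀ ∈ cube n) (h₁ : x₁ ∈ cube n) {i : Fin n}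
    (h : ∀ j, j ≠ i → x₁ j = x₀ j) (j : Fin n) :
    |discreteDeriv φ x₁ j - discreteDeriv φ x₀ j| ≤ c i j := by
  have := abs_sub_le_of_hasDerivWithinAt_unitInterval
    (G := fun s : ℝ => φ (Function.update x₁ j s) - φ (Function.update x₀ j s)) (M := c i j)
    (fun s hs => (hφ.hasDerivWithinAt_update h₁ j hs).sub (hφ.hasDerivWithinAt_update h₀ j hs))
    (fun s hs => by
      have m₁ := update_mem_cube h₁ j hs.1 hs.2
      have m₀ := update_mem_cube h₀ j hs.1 hs.2
      refine ((hc j).abs_sub_le_of_eq_off m₁ m₀ i (fun k hk => ?_)).trans ?_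
      · rcases eq_or_ne k j with rfl | hkj <;> simp [*]
      · refine mul_le_of_le_one_right (hc0 i j) ?_
        have a := mem_cube.1 m₁ i
        have b := mem_cube.1 m₀ i
        rw [abs_le]
        constructor <;> linarith [a.1, a.2, b.1, b.2])
  convert! this using 2
  simp [discreteDeriv]
  ring

/-- The conditional mean of `xᵢ` given the other coordinates under the weight `e^φ`. -/
noncomputable def condMean (φ : (Fin n → ℝ) → ℝ) (x : Fin n → ℝ) (i : Fin n) : ℝ :=
  Real.sigmoid (discreteDeriv φ x i)

theorem condMean_mem_cube (φ : (Fin n → ℝ) → ℝ) (x : Fin n → ℝ) : condMean φ x ∈ cube n :=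
  mem_cube.2 fun _ => ⟨Real.sigmoid_nonneg _, Real.sigmoid_le_one _⟩

theorem condMean_update (φ : (Fin n → ℝ) → ℝ) (x : Fin n → ℝ) (i : Fin n) (s : ℝ) :
    condMean φ (Function.update x i s) i = condMean φ x i := by
  rw [condMean, condMean, discreteDeriv_update]

theorem exp_update_eq_condMean_mul (φ : (Fin n → ℝ) → ℝ) (x : Fin n → ℝ) (i : Fin n) :
    Real.exp (φ (Function.update x i 1)) = condMean φ x i
      * (Real.exp (φ (Function.update x i 0)) + Real.exp (φ (Function.update x i 1))) := by
  rw [condMean, Real.sigmoid_def, discreteDeriv, neg_sub, Real.exp_sub]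
  have h0 := Real.exp_pos (φ (Function.update x i 0))
  have h1 := Real.exp_pos (φ (Function.update x i 1))
  field_simp
  ring

/-- The discrete derivative in direction `i` does not depend on `xᵢ`, so the resampling error is
exactly zero. -/
theorem sum_exp_mul_sub_condMean_mul_discreteDeriv (φ : (Fin n → ℝ) → ℝ) (i : Fin n) :
    ∑ x ∈ vertices n, Real.exp (φ x) * ((x i - condMean φ x i) * discreteDeriv φ x i) = 0 := by
  have := abs_sum_weight_sub_mul_le (W := fun x => Real.exp (φ x)) (p := fun x => condMean φ x i)
    (w := fun x => discreteDeriv φ x i) (M := 0) i (fun x _ => (Real.exp_pos _).le)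
    (fun x _ s => condMean_update φ x i s) (fun x _ => exp_update_eq_condMean_mul φ x i)
    (fun x _ => by simp [discreteDeriv_update])
  rw [zero_mul] at this
  exact abs_nonpos_iff.1 this

theorem sum_mul_swap_le (c : Fin n → Fin n → ℝ) :
    ∑ i, ∑ j, c j i * c i j ≤ ∑ i, ∑ j, c i j ^ 2 := by
  have h : ∑ i, ∑ j, c j i ^ 2 = ∑ i, ∑ j, c i j ^ 2 := Finset.sum_comm
  have : ∑ i, ∑ j, c j i * c i j ≤ ∑ i, ∑ j, (c j i ^ 2 / 2 + c i j ^ 2 / 2) :=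
    Finset.sum_le_sum fun i _ => Finset.sum_le_sum fun j _ => by
      nlinarith [sq_nonneg (c j i - c i j)]
  refine this.trans_eq ?_
  simp only [Finset.sum_add_distrib, ← Finset.sum_div, h]
  ring

/-- Flipping `xᵢ` moves the interpolated point by at most `c i j / 4` in each coordinate `j`,
through the conditional means, and by at most `1` more in coordinate `i`. Weighting by the Lipschitz
constants of `φ' i` gives `M i`. -/
theorem abs_sum_exp_mul_sub_condMean_le (hφ : HasGradient φ φ')
    (hc : ∀ j, CoordLipschitz (fun i => c i j) (φ' j)) (hc0 : ∀ i j, 0 ≤ c i j) :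
    |∑ x ∈ vertices n, Real.exp (φ x) * (φ x - φ (condMean φ x))|
      ≤ (∑ i, c i i + 1 / 16 * ∑ i, ∑ j, c i j ^ 2) * ∑ x ∈ vertices n, Real.exp (φ x) := by
  have h := abs_sum_weight_mul_sub_le hφ (W := fun x => Real.exp (φ x)) (v := fun _ => 1)
    (q := condMean φ) (M := fun i => c i i + 1 / 4 * ∑ j, c j i * c i j)
    (fun x _ => (Real.exp_pos _).le) (fun x _ => condMean_mem_cube φ x)
    (fun x _ i s => condMean_update φ x i s) (fun x _ i => exp_update_eq_condMean_mul φ x i)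
    (fun s hs i x₀ h₀ x₁ h₁ hx => by
      rw [one_mul, one_mul]
      have c₀ := vertices_subset_cube h₀
      have c₁ := vertices_subset_cube h₁
      refine (hc i _ (lineMap_mem_cube c₁ (condMean_mem_cube φ x₁) hs) _
        (lineMap_mem_cube c₀ (condMean_mem_cube φ x₀) hs)).trans ?_
      have hterm : ∀ j, c j i * |(condMean φ x₁ + s • (x₁ - condMean φ x₁)) j
          - (condMean φ x₀ + s • (x₀ - condMean φ x₀)) j|
          ≤ (if j = i then c i i else 0) + 1 / 4 * (c j i * c i j) := by
        intro j
        have hd : |condMean φ x₁ j - condMean φ x₀ j| ≤ 1 / 4 * c i j :=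
          (abs_sigmoid_sub_le _ _).trans (mul_le_mul_of_nonneg_left
            (abs_discreteDeriv_sub_le hφ hc hc0 c₀ c₁ hx j) (by norm_num))
        have hx1 : |x₁ j - x₀ j| ≤ if j = i then 1 else 0 := by
          split_ifs with hj
          · have a := mem_cube.1 c₁ j
            have b := mem_cube.1 c₀ j
            rw [abs_le]
            constructor <;> linarith [a.1, a.2, b.1, b.2]
          · simp [hx j hj]
        have e : (condMean φ x₁ + s • (x₁ - condMean φ x₁)) j
            - (condMean φ x₀ + s • (x₀ - condMean φ x₀)) j
            = (1 - s) * (condMean φ x₁ j - condMean φ x₀ j) + s * (x₁ j - x₀ j) := by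
          simp; ring
        have hb : |(condMean φ x₁ + s • (x₁ - condMean φ x₁)) j
            - (condMean φ x₀ + s • (x₀ - condMean φ x₀)) j|
            ≤ 1 / 4 * c i j + if j = i then 1 else 0 := by
          rw [e]
          refine (abs_add_le _ _).trans (add_le_add ?_ ?_)
          · rw [abs_mul, abs_of_nonneg (by linarith [hs.2] : 0 ≤ 1 - s)]
            exact (mul_le_of_le_one_left (abs_nonneg _) (by linarith [hs.1])).trans hd
          · rw [abs_mul, abs_of_nonneg hs.1]
            exact (mul_le_of_le_one_left (abs_nonneg _) hs.2).trans hx1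
        refine (mul_le_mul_of_nonneg_left hb (hc0 j i)).trans_eq ?_
        split_ifs with hj
        · subst hj; ring
        · ring
      refine (Finset.sum_le_sum fun j _ => hterm j).trans_eq ?_
      simp [Finset.sum_add_distrib, Finset.mul_sum])
  simp only [one_mul] at h
  refine h.trans (mul_le_mul_of_nonneg_right ?_ (Finset.sum_nonneg fun x _ => (Real.exp_pos _).le))
  have h1 := sum_mul_swap_le c
  have h2 : 0 ≤ ∑ i, c i i := Finset.sum_nonneg fun i _ => hc0 i i
  rw [Finset.sum_add_distrib, ← Finset.mul_sum]
  linarith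

/-- With `S = ∑ c i j ^ 2`, the preceding bound has error `S / 16`, while trivially `φ x - φ x̂ ≤
2a`. The smaller of `2a` and `S / 16` is at most their geometric mean, hence at most `√(a S)`. -/
theorem sum_exp_mul_sub_condMean_le (hφ : HasGradient φ φ') {a : ℝ}
    (ha : ∀ x ∈ cube n, |φ x| ≤ a)
    (hc : ∀ j, CoordLipschitz (fun i => c i j) (φ' j)) (hc0 : ∀ i j, 0 ≤ c i j) :
    ∑ x ∈ vertices n, Real.exp (φ x) * (φ x - φ (condMean φ x))
      ≤ (∑ i, c i i + √(a * ∑ i, ∑ j, c i j ^ 2)) * ∑ x ∈ vertices n, Real.exp (φ x) := by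
  have hZ : 0 ≤ ∑ x ∈ vertices n, Real.exp (φ x) := Finset.sum_nonneg fun x _ => (Real.exp_pos _).le
  have hC : 0 ≤ ∑ i, c i i := Finset.sum_nonneg fun i _ => hc0 i i
  have hS : 0 ≤ ∑ i, ∑ j, c i j ^ 2 :=
    Finset.sum_nonneg fun i _ => Finset.sum_nonneg fun j _ => sq_nonneg _
  have ha0 : 0 ≤ a := (abs_nonneg _).trans (ha _ (condMean_mem_cube φ 0))
  set S := ∑ i, ∑ j, c i j ^ 2
  rcases le_total (2 * a) (S / 16) with h | h
  · have h2a : 2 * a ≤ √(a * S) := Real.le_sqrt_of_sq_le (by nlinarith)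
    rw [Finset.mul_sum]
    refine Finset.sum_le_sum fun x hx => ?_
    rw [mul_comm]
    refine mul_le_mul_of_nonneg_right ?_ (Real.exp_pos _).le
    have a1 := abs_le.1 (ha x (vertices_subset_cube hx))
    have a2 := abs_le.1 (ha _ (condMean_mem_cube φ x))
    linarith
  · have h2a : S / 16 ≤ √(a * S) := Real.le_sqrt_of_sq_le (by nlinarith)
    refine (le_abs_self _).trans ((abs_sum_exp_mul_sub_condMean_le hφ hc hc0).trans ?_)
    exact mul_le_mul_of_nonneg_right (by linarith) hZ

end Smooth

/-! ### The partition function bounded by coding -/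

/-- The Bernoulli log-likelihood of the vertex `x` for the natural parameters `d`. -/
noncomputable def logLikelihood (d x : Fin n → ℝ) : ℝ := ∑ i, (x i * d i - logOneAddExp (d i))

theorem sum_exp_logLikelihood (d : Fin n → ℝ) :
    ∑ x ∈ vertices n, Real.exp (logLikelihood d x) = 1 := by
  simp only [logLikelihood, Real.exp_sum]
  rw [sum_vertices_prod fun i s => Real.exp (s * d i - logOneAddExp (d i))]
  refine Finset.prod_eq_one fun i _ => ?_
  have := Real.exp_pos (d i)
  rw [zero_mul, one_mul, zero_sub, Real.exp_sub, Real.exp_neg, logOneAddExp,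
    Real.exp_log (by positivity)]
  field_simp

theorem entropyI_sigmoid (d : Fin n → ℝ) :
    entropyI (fun i => Real.sigmoid (d i))
      = ∑ i, (Real.sigmoid (d i) * d i - logOneAddExp (d i)) := by
  refine Finset.sum_congr rfl fun i _ => ?_
  rw [log_sigmoid, log_one_sub_sigmoid]
  ring

/-- Gibbs' variational bound, with the entropy of the maximising law estimated by coding a
configuration `x` through an element `d x` of the finite set `D`. -/
theorem log_sum_exp_le_of_code {φ : (Fin n → ℝ) → ℝ} {D : Finset (Fin n → ℝ)}
    {d : (Fin n → ℝ) → Fin n → ℝ} (hd : ∀ x ∈ vertices n, d x ∈ D) {R : ℝ}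
    (hR : ∑ x ∈ vertices n, Real.exp (φ x) * (φ x - logLikelihood (d x) x)
      ≤ R * ∑ x ∈ vertices n, Real.exp (φ x)) :
    Real.log (∑ x ∈ vertices n, Real.exp (φ x)) ≤ R + Real.log D.card := by
  set Z := ∑ x ∈ vertices n, Real.exp (φ x) with hZdef
  have hZ : 0 < Z := Finset.sum_pos (fun x _ => Real.exp_pos _) vertices_nonempty
  have hD : (0 : ℝ) < D.card := by
    obtain ⟨x, hx⟩ := vertices_nonempty (n := n)
    exact_mod_cast Finset.card_pos.2 ⟨_, hd x hx⟩
  -- Each codeword carries a probability law, and `x` is charged only to its own codeword, so the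
  -- total is at most the number of codewords.
  have hsum : ∑ x ∈ vertices n, Real.exp (logLikelihood (d x) x) ≤ D.card := by
    calc _ ≤ ∑ x ∈ vertices n, ∑ e ∈ D, Real.exp (logLikelihood e x) :=
          Finset.sum_le_sum fun x hx => Finset.single_le_sum
            (f := fun e => Real.exp (logLikelihood e x)) (fun e _ => (Real.exp_pos _).le) (hd x hx)
      _ = _ := by rw [Finset.sum_comm]; simp [sum_exp_logLikelihood]
  -- Jensen for `exp` under the Gibbs law `e^φ / Z`.
  have hJ := convexOn_exp.map_sum_le (t := vertices n) (w := fun x => Real.exp (φ x) / Z)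
    (p := fun x => logLikelihood (d x) x - φ x) (fun x _ => by positivity)
    (by rw [← Finset.sum_div, ← hZdef, div_self hZ.ne']) (fun _ _ => Set.mem_univ _)
  have e1 : ∑ x ∈ vertices n, (Real.exp (φ x) / Z) • Real.exp (logLikelihood (d x) x - φ x)
      = (∑ x ∈ vertices n, Real.exp (logLikelihood (d x) x)) / Z := by
    rw [Finset.sum_div]
    refine Finset.sum_congr rfl fun x _ => ?_
    rw [Real.exp_sub, smul_eq_mul]
    have := Real.exp_pos (φ x)
    field_simp
  have e2 : -R ≤ ∑ x ∈ vertices n, (Real.exp (φ x) / Z) • (logLikelihood (d x) x - φ x) := by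
    have : ∑ x ∈ vertices n, (Real.exp (φ x) / Z) • (logLikelihood (d x) x - φ x)
        = -((∑ x ∈ vertices n, Real.exp (φ x) * (φ x - logLikelihood (d x) x)) / Z) := by
      rw [Finset.sum_div, ← Finset.sum_neg_distrib]
      refine Finset.sum_congr rfl fun x _ => ?_
      rw [smul_eq_mul]
      ring
    rw [this, neg_le_neg_iff, div_le_iff₀ hZ]
    exact hR
  rw [e1] at hJ
  have h1 : Real.exp (-R) ≤ D.card / Z :=
    (Real.exp_le_exp.2 e2).trans (hJ.trans (div_le_div_of_nonneg_right hsum hZ.le))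
  have h2 := (Real.le_log_iff_exp_le (by positivity)).2 h1
  rw [Real.log_div hD.ne' hZ.ne'] at h2
  linarith

theorem sum_mul_le_sqrt_sum_sq_mul_sqrt_sum_sq (u v : Fin n → ℝ) :
    ∑ i, u i * v i ≤ √(∑ i, u i ^ 2) * √(∑ i, v i ^ 2) :=
  Real.sum_mul_le_sqrt_mul_sqrt _ _ _

/-- The nonlinear large deviation upper bound for the partition function of `φ`. -/
theorem log_sum_exp_le {φ : (Fin n → ℝ) → ℝ} {φ' : Fin n → (Fin n → ℝ) → ℝ}
    {b : Fin n → ℝ} {c : Fin n → Fin n → ℝ} (hφ : HasGradient φ φ') {a : ℝ}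
    (ha : ∀ x ∈ cube n, |φ x| ≤ a) (hb : ∀ i, ∀ x ∈ cube n, |φ' i x| ≤ b i)
    (hc : ∀ j, CoordLipschitz (fun i => c i j) (φ' j)) (hc0 : ∀ i j, 0 ≤ c i j)
    {D : Finset (Fin n → ℝ)} {ε : ℝ} (hε : 0 ≤ ε)
    (hD : ∀ x ∈ cube n, ∃ d ∈ D, ∑ i, (φ' i x - d i) ^ 2 ≤ n * ε ^ 2)
    {M : ℝ} (hM : ∀ x ∈ cube n, φ x - entropyI x ≤ M) :
    Real.log (∑ x ∈ vertices n, Real.exp (φ x)) ≤ M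
      + (1 / 4 * √(n * ∑ i, b i ^ 2) * ε + 2 * n * ε + Real.log D.card)
      + (√(a * ∑ i, ∑ j, c i j ^ 2) + 1 / 4 * √(∑ i, b i ^ 2) * √(∑ i, c i i ^ 2)
        + 3 * ∑ i, c i i) := by
  choose! d hdD hd using hD
  set Z := ∑ x ∈ vertices n, Real.exp (φ x) with hZdef
  set C := ∑ i, c i i
  set E := 1 / 4 * √(∑ i, b i ^ 2) * (√n * ε + √(∑ i, c i i ^ 2)) + 2 * (n * ε + C) with hE
  have hl2 : ∀ x ∈ cube n, √(∑ i, |φ' i x - d x i| ^ 2) ≤ √n * ε := fun x hx => by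
    simp only [sq_abs]
    rw [← Real.sqrt_sq hε, ← Real.sqrt_mul (Nat.cast_nonneg n)]
    exact Real.sqrt_le_sqrt (hd x hx)
  have hΔ : ∀ x ∈ cube n, ∀ i, |discreteDeriv φ x i - d x i| ≤ |φ' i x - d x i| + c i i := by
    intro x hx i
    have := abs_discreteDeriv_sub_gradient_le hφ hc hc0 hx i
    have := abs_sub_le (discreteDeriv φ x i) (φ' i x) (d x i)
    linarith
  have hl1 : ∀ x ∈ cube n, ∑ i, |discreteDeriv φ x i - d x i| ≤ n * ε + C := by
    intro x hx
    refine (Finset.sum_le_sum fun i _ => hΔ x hx i).trans ?_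
    rw [Finset.sum_add_distrib]
    have h1 := sum_mul_le_sqrt_sum_sq_mul_sqrt_sum_sq (fun _ : Fin n => 1) (fun i => |φ' i x - d x i|)
    simp only [one_mul, one_pow, Finset.sum_const, Finset.card_univ, Fintype.card_fin,
      nsmul_eq_mul, mul_one] at h1
    have h2 := mul_le_mul_of_nonneg_left (hl2 x hx) (Real.sqrt_nonneg n)
    rw [← mul_assoc, Real.mul_self_sqrt (Nat.cast_nonneg n)] at h2
    linarith
  -- The last sum is kept exact, since its Gibbs mean is zero.
  have hpoint : ∀ x ∈ vertices n, φ x - logLikelihood (d x) x ≤ (φ x - φ (condMean φ x)) + M + E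
      - ∑ i, (x i - condMean φ x i) * discreteDeriv φ x i := by
    intro x hx
    have hxc := vertices_subset_cube hx
    set p : Fin n → ℝ := fun i => Real.sigmoid (d x i) with hp
    have hpc : p ∈ cube n := mem_cube.2 fun i => ⟨Real.sigmoid_nonneg _, Real.sigmoid_le_one _⟩
    have h1 := hM p hpc
    have h2 : φ (condMean φ x) - φ p
        ≤ 1 / 4 * √(∑ i, b i ^ 2) * (√n * ε + √(∑ i, c i i ^ 2)) := by
      refine (le_abs_self _).trans ((hφ.coordLipschitz hb _ (condMean_mem_cube φ x) _ hpc).trans ?_)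
      have hb0 : ∀ i, 0 ≤ b i := fun i => (abs_nonneg _).trans (hb i p hpc)
      have h3 : ∑ i, b i * |condMean φ x i - p i|
          ≤ ∑ i, (1 / 4 * (b i * |φ' i x - d x i|) + 1 / 4 * (b i * c i i)) := by
        refine Finset.sum_le_sum fun i _ => ?_
        have := (abs_sigmoid_sub_le (discreteDeriv φ x i) (d x i)).trans
          (mul_le_mul_of_nonneg_left (hΔ x hxc i) (by norm_num))
        have := mul_le_mul_of_nonneg_left this (hb0 i)
        simp only [condMean, hp]
        linarith
      refine h3.trans ?_
      rw [Finset.sum_add_distrib, ← Finset.mul_sum, ← Finset.mul_sum]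
      have h4 := sum_mul_le_sqrt_sum_sq_mul_sqrt_sum_sq b (fun i => |φ' i x - d x i|)
      have h5 := sum_mul_le_sqrt_sum_sq_mul_sqrt_sum_sq b (fun i => c i i)
      have h6 := mul_le_mul_of_nonneg_left (hl2 x hxc) (Real.sqrt_nonneg (∑ i, b i ^ 2))
      linarith
    have h3 : entropyI p - logLikelihood (d x) x
        ≤ 2 * (n * ε + C) - ∑ i, (x i - condMean φ x i) * discreteDeriv φ x i := by
      rw [hp, entropyI_sigmoid, logLikelihood, ← Finset.sum_sub_distrib]
      -- Both summands are 1-Lipschitz in the parameter. Replacing `d x i` by the discrete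
      -- derivative costs twice the distance and leaves `(x̂ᵢ - xᵢ)` times that derivative.
      have h4 : ∑ i, (Real.sigmoid (d x i) * d x i - logOneAddExp (d x i)
          - (x i * d x i - logOneAddExp (d x i)))
          ≤ ∑ i, (2 * |discreteDeriv φ x i - d x i|
            - (x i - condMean φ x i) * discreteDeriv φ x i) := by
        refine Finset.sum_le_sum fun i _ => ?_
        have b1 := (abs_le.1 (abs_bernoulliLogLikelihood_sub_le (mem_vertices.1 hx i)
          (discreteDeriv φ x i) (d x i))).2
        have b2 := (abs_le.1 (abs_bernoulliEntropy_sub_le (discreteDeriv φ x i) (d x i))).1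
        simp only [condMean]
        linarith
      refine h4.trans ?_
      rw [Finset.sum_sub_distrib, ← Finset.mul_sum]
      have := hl1 x hxc
      linarith
    linarith
  have hR : ∑ x ∈ vertices n, Real.exp (φ x) * (φ x - logLikelihood (d x) x)
      ≤ (C + √(a * ∑ i, ∑ j, c i j ^ 2) + M + E) * Z := by
    have hz : ∑ x ∈ vertices n, Real.exp (φ x)
        * ∑ i, (x i - condMean φ x i) * discreteDeriv φ x i = 0 := by
      simp only [Finset.mul_sum]
      rw [Finset.sum_comm]
      exact Finset.sum_eq_zero fun i _ => sum_exp_mul_sub_condMean_mul_discreteDeriv φ i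
    calc _ ≤ ∑ x ∈ vertices n, (Real.exp (φ x) * (φ x - φ (condMean φ x))
          + (M + E) * Real.exp (φ x)
          - Real.exp (φ x) * ∑ i, (x i - condMean φ x i) * discreteDeriv φ x i) :=
          Finset.sum_le_sum fun x hx => by
            have := mul_le_mul_of_nonneg_left (hpoint x hx) (Real.exp_pos (φ x)).le
            linarith
      _ = ∑ x ∈ vertices n, Real.exp (φ x) * (φ x - φ (condMean φ x)) + (M + E) * Z := by
          rw [Finset.sum_sub_distrib, hz, Finset.sum_add_distrib, ← Finset.mul_sum, sub_zero]
      _ ≤ _ := by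
          have := sum_exp_mul_sub_condMean_le hφ ha hc hc0
          linarith
  refine (log_sum_exp_le_of_code (fun x hx => hdD x (vertices_subset_cube hx)) hR).trans_eq ?_
  rw [hE, Real.sqrt_mul (Nat.cast_nonneg n)]
  ring


/-! ### Twice continuously differentiable functions on the cube -/

theorem uniqueDiffOn_cube : UniqueDiffOn ℝ (cube n) := by
  refine uniqueDiffOn_convex convex_cube ⟨fun _ => 1 / 2, ?_⟩
  rw [cube, ← Set.pi_univ_Icc, interior_pi_set Set.finite_univ]
  intro i _
  simp only [Pi.zero_apply, Pi.one_apply, interior_Icc]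
  constructor <;> norm_num

theorem abs_le_supNorm {f : (Fin n → ℝ) → ℝ} (hf : ContinuousOn f (cube n)) {x : Fin n → ℝ}
    (hx : x ∈ cube n) : |f x| ≤ supNorm f := by
  have hb : BddAbove ((fun x => |f x|) '' cube n) :=
    (isCompact_Icc (a := (0 : Fin n → ℝ)) (b := 1)).bddAbove_image hf.abs
  rw [Set.image_eq_range] at hb
  exact le_ciSup (f := fun x : cube n => |f x|) hb ⟨x, hx⟩

theorem supNorm_nonneg (f : (Fin n → ℝ) → ℝ) : 0 ≤ supNorm f :=
  Real.iSup_nonneg fun _ => abs_nonneg _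

theorem hasGradient_pd {f : (Fin n → ℝ) → ℝ} (hf : DifferentiableOn ℝ f (cube n)) :
    HasGradient f (fun i => pd i f) := by
  intro x hx
  convert! (hf x hx).hasFDerivWithinAt using 1
  ext v
  conv_rhs => rw [pi_eq_sum_univ' v, map_sum]
  simp [pd, mul_comm]

theorem contDiffOn_pd {f : (Fin n → ℝ) → ℝ} {m k : ℕ} (hf : ContDiffOn ℝ k f (cube n))
    (hmk : m + 1 ≤ k) (i : Fin n) : ContDiffOn ℝ m (pd i f) (cube n) :=
  (hf.fderivWithin uniqueDiffOn_cube (by exact_mod_cast hmk)).clm_apply contDiffOn_const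

theorem abs_pd_le {f : (Fin n → ℝ) → ℝ} (hf : ContDiffOn ℝ 2 f (cube n)) (i : Fin n)
    {x : Fin n → ℝ} (hx : x ∈ cube n) : |pd i f x| ≤ norm₁ f i :=
  abs_le_supNorm (contDiffOn_pd (m := 1) (k := 2) hf le_rfl i).continuousOn hx

theorem coordLipschitz_norm₁ {f : (Fin n → ℝ) → ℝ} (hf : ContDiffOn ℝ 2 f (cube n)) :
    CoordLipschitz (norm₁ f) f :=
  (hasGradient_pd (hf.differentiableOn (by norm_num))).coordLipschitz
    fun i _ hx => abs_pd_le hf i hx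

theorem coordLipschitz_pd {f : (Fin n → ℝ) → ℝ} (hf : ContDiffOn ℝ 2 f (cube n)) (j : Fin n) :
    CoordLipschitz (fun i => norm₂ f i j) (pd j f) := by
  have h1 := contDiffOn_pd (m := 1) (k := 2) hf le_rfl j
  exact (hasGradient_pd (h1.differentiableOn (by norm_num))).coordLipschitz fun i _ hx =>
    abs_le_supNorm (contDiffOn_pd (m := 0) (k := 1) h1 le_rfl i).continuousOn hx

/-! ### A smooth penalty -/

theorem hasDerivAt_sq_max_zero (x : ℝ) :
    HasDerivAt (fun x : ℝ => max x 0 ^ 2) (2 * max x 0) x := by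
  rcases lt_trichotomy x 0 with hx | rfl | hx
  · rw [max_eq_right hx.le, mul_zero]
    refine (hasDerivAt_const x (0 : ℝ)).congr_of_eventuallyEq ?_
    filter_upwards [Iio_mem_nhds hx] with y hy
    rw [max_eq_right (le_of_lt (Set.mem_Iio.1 hy))]
    norm_num
  · rw [max_self, mul_zero, hasDerivAt_iff_isLittleO]
    refine Asymptotics.IsBigO.trans_isLittleO (g := fun x : ℝ => x ^ 2) ?_ ?_
    · refine Asymptotics.isBigO_of_le _ fun y => ?_
      simp only [max_self, smul_zero, Real.norm_eq_abs]
      rcases le_total y 0 with h | h <;> simp [h, sq_nonneg]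
    · simpa using Asymptotics.isLittleO_pow_id (𝕜 := ℝ) (n := 2) (by norm_num)
  · rw [max_eq_left hx.le]
    have := (hasDerivAt_pow 2 x)
    refine HasDerivAt.congr_of_eventuallyEq (f := fun x => x ^ 2) (by simpa using this) ?_
    filter_upwards [Ioi_mem_nhds hx] with y hy
    rw [max_eq_left (le_of_lt (Set.mem_Ioi.1 hy))]

/-- A differentiable step function, from `0` on the negative axis to `1` on `[1, ∞)`. -/
noncomputable def step (x : ℝ) : ℝ :=
  2 * max x 0 ^ 2 - 4 * max (x - 1 / 2) 0 ^ 2 + 2 * max (x - 1) 0 ^ 2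

/-- The derivative of `step`. -/
noncomputable def tent (x : ℝ) : ℝ :=
  4 * max x 0 - 8 * max (x - 1 / 2) 0 + 4 * max (x - 1) 0

theorem hasDerivAt_step (x : ℝ) : HasDerivAt step (tent x) x := by
  have h : ∀ c : ℝ, HasDerivAt (fun x : ℝ => max (x - c) 0 ^ 2) (2 * max (x - c) 0) x := fun c =>
    (hasDerivAt_sq_max_zero (x - c)).comp_sub_const x c
  have := (((hasDerivAt_sq_max_zero x).const_mul 2).sub ((h (1 / 2)).const_mul 4)).add
    ((h 1).const_mul 2)
  convert! this using 1
  rw [tent]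
  ring

theorem step_of_nonpos {x : ℝ} (hx : x ≤ 0) : step x = 0 := by
  rw [step, max_eq_right hx, max_eq_right (by linarith), max_eq_right (by linarith)]
  norm_num

theorem step_of_one_le {x : ℝ} (hx : 1 ≤ x) : step x = 1 := by
  rw [step, max_eq_left (by linarith), max_eq_left (by linarith), max_eq_left (by linarith)]
  ring

theorem tent_of_nonpos {x : ℝ} (hx : x ≤ 0) : tent x = 0 := by
  rw [tent, max_eq_right hx, max_eq_right (by linarith), max_eq_right (by linarith)]
  norm_num

/-- In this form the height `2` and the Lipschitz constant `4` are visible; the triangle inequality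
on the sum of positive parts would only give `16`. -/
theorem tent_eq (x : ℝ) : tent x = max 0 (min (4 * x) (4 - 4 * x)) := by
  rw [tent]
  rcases le_total x 0 with h0 | h0
  · rw [max_eq_right h0, max_eq_right (by linarith), max_eq_right (by linarith),
      min_eq_left (by linarith), max_eq_left (by linarith)]
    norm_num
  rcases le_total x (1 / 2) with h1 | h1
  · rw [max_eq_left h0, max_eq_right (by linarith), max_eq_right (by linarith),
      min_eq_left (by linarith), max_eq_right (by linarith)]
    norm_num
  rcases le_total x 1 with h2 | h2
  · rw [max_eq_left h0, max_eq_left (by linarith), max_eq_right (by linarith),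
      min_eq_right (by linarith), max_eq_right (by linarith)]
    ring
  · rw [max_eq_left h0, max_eq_left (by linarith), max_eq_left (by linarith),
      min_eq_right (by linarith), max_eq_left (by linarith)]
    ring

theorem tent_nonneg (x : ℝ) : 0 ≤ tent x := by
  rw [tent_eq]
  exact le_max_left _ _

theorem tent_le_two (x : ℝ) : tent x ≤ 2 := by
  rw [tent_eq]
  refine max_le (by norm_num) ?_
  rcases le_total (4 * x) 2 with h | h
  · exact (min_le_left _ _).trans h
  · exact (min_le_right _ _).trans (by linarith)

theorem abs_tent_sub_le (x y : ℝ) : |tent x - tent y| ≤ 4 * |x - y| := by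
  rw [tent_eq, tent_eq]
  refine (abs_max_sub_max_le_max _ _ _ _).trans ?_
  rw [sub_self, abs_zero]
  refine max_le (by positivity) ((abs_min_sub_min_le_max _ _ _ _).trans (max_le ?_ ?_))
  · rw [← mul_sub, abs_mul, abs_of_pos (by norm_num : (0 : ℝ) < 4)]
  · rw [show 4 - 4 * x - (4 - 4 * y) = -(4 * (x - y)) by ring, abs_neg, abs_mul,
      abs_of_pos (by norm_num : (0 : ℝ) < 4)]

theorem monotone_step : Monotone step :=
  monotone_of_hasDerivAt_nonneg hasDerivAt_step tent_nonneg

theorem step_nonneg (x : ℝ) : 0 ≤ step x := by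
  rcases le_total x 0 with h | h
  · exact (step_of_nonpos h).ge
  · rw [← step_of_nonpos le_rfl]
    exact monotone_step h

theorem step_le_one (x : ℝ) : step x ≤ 1 := by
  rcases le_total x 1 with h | h
  · rw [← step_of_one_le le_rfl]
    exact monotone_step h
  · exact (step_of_one_le h).le

/-- A penalty which vanishes for `|u| ≤ r` and equals `1` for `|u| ≥ r + w`. -/
noncomputable def penalty (r w u : ℝ) : ℝ := step ((u - r) / w) + step ((-u - r) / w)

/-- The derivative of `penalty`. -/
noncomputable def penaltyDeriv (r w u : ℝ) : ℝ :=
  (tent ((u - r) / w) - tent ((-u - r) / w)) / w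

section Penalty

variable {r w : ℝ}

theorem hasDerivAt_penalty (r w u : ℝ) :
    HasDerivAt (penalty r w) (penaltyDeriv r w u) u := by
  have h1 : HasDerivAt (fun u : ℝ => (u - r) / w) (1 / w) u :=
    ((hasDerivAt_id u).sub_const r).div_const w
  have h2 : HasDerivAt (fun u : ℝ => (-u - r) / w) (-1 / w) u :=
    ((hasDerivAt_neg u).sub_const r).div_const w
  have := ((hasDerivAt_step _).comp u h1).add ((hasDerivAt_step _).comp u h2)
  convert! this using 1
  rw [penaltyDeriv]
  ring

theorem penalty_neg (r w u : ℝ) : penalty r w (-u) = penalty r w u := by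
  rw [penalty, penalty, neg_neg, add_comm]

theorem penaltyDeriv_neg (r w u : ℝ) : penaltyDeriv r w (-u) = -penaltyDeriv r w u := by
  rw [penaltyDeriv, penaltyDeriv, neg_neg]
  ring

/-- Because `r ≥ 0`, only one of the two steps is active on each half-line. -/
theorem penalty_of_nonneg (hr : 0 ≤ r) (hw : 0 < w) {u : ℝ} (hu : 0 ≤ u) :
    penalty r w u = step ((u - r) / w) := by
  rw [penalty, step_of_nonpos (x := (-u - r) / w), add_zero]
  exact div_nonpos_of_nonpos_of_nonneg (by linarith) hw.le

theorem penaltyDeriv_of_nonneg (hr : 0 ≤ r) (hw : 0 < w) {u : ℝ} (hu : 0 ≤ u) :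
    penaltyDeriv r w u = tent ((u - r) / w) / w := by
  rw [penaltyDeriv, tent_of_nonpos (x := (-u - r) / w), sub_zero]
  exact div_nonpos_of_nonpos_of_nonneg (by linarith) hw.le

theorem penalty_abs (r w u : ℝ) : penalty r w |u| = penalty r w u := by
  rcases abs_choice u with h | h <;> rw [h]
  exact penalty_neg r w u

theorem penalty_nonneg (r w u : ℝ) : 0 ≤ penalty r w u :=
  add_nonneg (step_nonneg _) (step_nonneg _)

theorem penalty_le_one (hr : 0 ≤ r) (hw : 0 < w) (u : ℝ) : penalty r w u ≤ 1 := by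
  rw [← penalty_abs, penalty_of_nonneg hr hw (abs_nonneg u)]
  exact step_le_one _

theorem penalty_eq_zero (hr : 0 ≤ r) (hw : 0 < w) {u : ℝ} (hu : |u| ≤ r) :
    penalty r w u = 0 := by
  rw [← penalty_abs, penalty_of_nonneg hr hw (abs_nonneg u), step_of_nonpos]
  exact div_nonpos_of_nonpos_of_nonneg (by linarith) hw.le

theorem penalty_eq_one (hr : 0 ≤ r) (hw : 0 < w) {u : ℝ} (hu : r + w ≤ |u|) :
    penalty r w u = 1 := by
  rw [← penalty_abs, penalty_of_nonneg hr hw (abs_nonneg u), step_of_one_le]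
  rw [le_div_iff₀ hw]
  linarith

theorem abs_penaltyDeriv_le (hw : 0 < w) (u : ℝ) : |penaltyDeriv r w u| ≤ 2 / w := by
  rw [penaltyDeriv, abs_div, abs_of_pos hw]
  refine div_le_div_of_nonneg_right ?_ hw.le
  have a := tent_nonneg ((u - r) / w)
  have b := tent_nonneg ((-u - r) / w)
  have c := tent_le_two ((u - r) / w)
  have d := tent_le_two ((-u - r) / w)
  rw [abs_le]
  constructor <;> linarith

theorem abs_penaltyDeriv_sub_le_of_nonneg (hr : 0 ≤ r) (hw : 0 < w) {u v : ℝ} (hu : 0 ≤ u)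
    (hv : 0 ≤ v) : |penaltyDeriv r w u - penaltyDeriv r w v| ≤ 4 / w ^ 2 * |u - v| := by
  rw [penaltyDeriv_of_nonneg hr hw hu, penaltyDeriv_of_nonneg hr hw hv, ← sub_div, abs_div,
    abs_of_pos hw]
  refine (div_le_div_of_nonneg_right (abs_tent_sub_le _ _) hw.le).trans_eq ?_
  rw [← sub_div, abs_div, abs_of_pos hw, show u - r - (v - r) = u - v by ring]
  field_simp

/-- The derivative vanishes at `0`, and the distances from `u` and `v` to `0` add up to `|u - v|`,
so the constant is not doubled. -/
theorem abs_penaltyDeriv_sub_le_of_nonneg_of_nonpos (hr : 0 ≤ r) (hw : 0 < w) {u v : ℝ}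
    (hu : 0 ≤ u) (hv : v ≤ 0) :
    |penaltyDeriv r w u - penaltyDeriv r w v| ≤ 4 / w ^ 2 * |u - v| := by
  have h0 : penaltyDeriv r w 0 = 0 := by
    have := penaltyDeriv_neg r w 0
    rw [neg_zero] at this
    linarith
  have h1 := abs_penaltyDeriv_sub_le_of_nonneg hr hw hu le_rfl
  have h2 := abs_penaltyDeriv_sub_le_of_nonneg hr hw (neg_nonneg.2 hv) le_rfl
  rw [penaltyDeriv_neg, h0, sub_zero, sub_zero, abs_neg, abs_neg, abs_of_nonpos hv] at h2
  rw [h0, sub_zero, sub_zero, abs_of_nonneg hu] at h1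
  rw [abs_of_nonneg (by linarith : 0 ≤ u - v)]
  refine (abs_sub _ _).trans ?_
  linarith

theorem abs_penaltyDeriv_sub_le (hr : 0 ≤ r) (hw : 0 < w) (u v : ℝ) :
    |penaltyDeriv r w u - penaltyDeriv r w v| ≤ 4 / w ^ 2 * |u - v| := by
  rcases le_total 0 u with hu | hu <;> rcases le_total 0 v with hv | hv
  · exact abs_penaltyDeriv_sub_le_of_nonneg hr hw hu hv
  · exact abs_penaltyDeriv_sub_le_of_nonneg_of_nonpos hr hw hu hv
  · rw [abs_sub_comm, abs_sub_comm u]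
    exact abs_penaltyDeriv_sub_le_of_nonneg_of_nonpos hr hw hv hu
  · have := abs_penaltyDeriv_sub_le_of_nonneg hr hw (neg_nonneg.2 hu) (neg_nonneg.2 hv)
    rw [penaltyDeriv_neg, penaltyDeriv_neg, ← neg_sub', abs_neg, ← neg_sub', abs_neg] at this
    exact this

end Penalty

/-! ### Gradient covers of the penalised function -/

theorem exists_finset_card_le_cover_Icc (R : ℝ) {N : ℕ} (hN : 0 < N) :
    ∃ G : Finset ℝ, G.card ≤ N ∧ ∀ θ : ℝ, |θ| ≤ R → ∃ g ∈ G, |g| ≤ R ∧ |θ - g| ≤ R / N := by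
  have hN' : (0 : ℝ) < N := Nat.cast_pos.2 hN
  -- Midpoints of `N` equal subintervals of `[-R, R]`.
  refine ⟨(Finset.range N).image fun k : ℕ => -R + (2 * k + 1) * R / N,
    Finset.card_image_le.trans (by simp), fun θ hθ => ?_⟩
  have hR : 0 ≤ R := (abs_nonneg _).trans hθ
  rw [abs_le] at hθ
  rcases hR.eq_or_lt with rfl | hR
  · exact ⟨_, Finset.mem_image_of_mem _ (Finset.mem_range.2 hN), by
      simp; exact le_antisymm hθ.2 (by simpa using hθ.1)⟩
  set y := (θ + R) * N / (2 * R) with hy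
  have hy0 : 0 ≤ y := by
    have : 0 ≤ θ + R := by linarith
    positivity
  have hyN : y ≤ N := by
    rw [hy, div_le_iff₀ (by positivity)]
    nlinarith
  -- The right endpoint `θ = R` gives `y = N`, which belongs to the last cell.
  have hex : ∃ k : ℕ, k < N ∧ (k : ℝ) ≤ y ∧ y ≤ k + 1 := by
    rcases hyN.eq_or_lt with h | h
    · refine ⟨N - 1, by omega, ?_, ?_⟩ <;> rw [h, Nat.cast_sub hN] <;> simp
    · exact ⟨⌊y⌋₊, (Nat.floor_lt hy0).2 h, Nat.floor_le hy0, (Nat.lt_floor_add_one y).le⟩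
  obtain ⟨k, hkN, h1, h2⟩ := hex
  refine ⟨_, Finset.mem_image_of_mem _ (Finset.mem_range.2 hkN), ?_, ?_⟩
  · have hk : (k : ℝ) + 1 ≤ N := by exact_mod_cast hkN
    have hk0 : (0 : ℝ) ≤ k := Nat.cast_nonneg k
    have h3 : (2 * k + 1) * R / N ≤ 2 * R := by
      rw [div_le_iff₀ hN']
      nlinarith
    have h4 : 0 ≤ (2 * k + 1) * R / N := by positivity
    rw [abs_le]
    constructor <;> linarith
  have hθy : θ = -R + 2 * y * R / N := by
    rw [hy]
    field_simp
    ring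
  have e : θ - (-R + (2 * k + 1) * R / N) = (2 * y - 2 * k - 1) * (R / N) := by
    rw [hθy]
    ring
  rw [e, abs_mul, abs_of_nonneg (by positivity : 0 ≤ R / N)]
  refine mul_le_of_le_one_left (by positivity) ?_
  rw [abs_le]
  constructor <;> linarith

/-- For `q ≥ 1` the ceiling is at most `q + 1 ≤ 2q`. This is the origin of the `max` and of the `12
= 2 · 6` in the complexity term. -/
theorem exists_nat_ge_le_max (q : ℝ) : ∃ N : ℕ, 0 < N ∧ q ≤ N ∧ (N : ℝ) ≤ max 1 (2 * q) := by
  rcases le_total q 1 with h | h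
  · exact ⟨1, one_pos, by simpa using h, by simp⟩
  · refine ⟨⌈q⌉₊, Nat.ceil_pos.2 (by linarith), Nat.le_ceil q, le_max_of_le_right ?_⟩
    linarith [Nat.ceil_lt_add_one (by linarith : 0 ≤ q)]

/-- A cover for `u + θ v` from covers for `u`, `v` and an interval containing the values of `θ`. -/
theorem exists_cover_add_mul {α : Type*} {s : Set α} {u v : Fin n → α → ℝ} {θ : α → ℝ}
    {β : Fin n → ℝ} {R ε ρ : ℝ} {N : ℕ} (hN : 0 < N) (hR : 0 ≤ R)
    (hρ : 3 * (R * ρ) ≤ ε) (hρ0 : 0 ≤ ρ)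
    (hθ : ∀ x ∈ s, |θ x| ≤ R) (hv : ∀ i, ∀ x ∈ s, |v i x| ≤ β i)
    (hNR : 3 * (R / N * √(∑ i, β i ^ 2)) ≤ √n * ε)
    {A B : Finset (Fin n → ℝ)}
    (hA : ∀ x ∈ s, ∃ d ∈ A, ∑ i, (u i x - d i) ^ 2 ≤ n * (ε / 3) ^ 2)
    (hB : ∀ x ∈ s, ∃ d ∈ B, ∑ i, (v i x - d i) ^ 2 ≤ n * ρ ^ 2) :
    ∃ D : Finset (Fin n → ℝ), D.card ≤ N * (A.card * B.card) ∧
      ∀ x ∈ s, ∃ d ∈ D, ∑ i, (u i x + θ x * v i x - d i) ^ 2 ≤ n * ε ^ 2 := by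
  classical
  obtain ⟨G, hG, hGc⟩ := exists_finset_card_le_cover_Icc R hN
  refine ⟨(G ×ˢ (A ×ˢ B)).image fun z => fun i => z.2.1 i + z.1 * z.2.2 i, ?_, fun x hx => ?_⟩
  · refine Finset.card_image_le.trans ?_
    rw [Finset.card_product, Finset.card_product]
    exact Nat.mul_le_mul_right _ hG
  · obtain ⟨g, hg, hgR, hgθ⟩ := hGc _ (hθ x hx)
    obtain ⟨d, hd, hdu⟩ := hA x hx
    obtain ⟨e, he, hev⟩ := hB x hx
    refine ⟨_, Finset.mem_image_of_mem _
      (Finset.mk_mem_product hg (Finset.mk_mem_product hd he)), ?_⟩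
    -- The errors come from covering `u`, rounding `θ` and covering `v`. Each has squared norm at
    -- most `n (ε/3)²`, and `(p + q + r)² ≤ 3 (p² + q² + r²)`.
    have h3 : ∀ i, (u i x + θ x * v i x - (d i + g * e i)) ^ 2
        ≤ 3 * (u i x - d i) ^ 2 + 3 * ((R / N) ^ 2 * β i ^ 2)
          + 3 * (R ^ 2 * (v i x - e i) ^ 2) := by
      intro i
      have b1 : ((θ x - g) * v i x) ^ 2 ≤ (R / N) ^ 2 * β i ^ 2 := by
        rw [mul_pow]
        exact mul_le_mul (sq_le_sq.2 (hgθ.trans (le_abs_self _)))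
          (sq_le_sq.2 ((hv i x hx).trans (le_abs_self _))) (sq_nonneg _) (sq_nonneg _)
      have b2 : (g * (v i x - e i)) ^ 2 ≤ R ^ 2 * (v i x - e i) ^ 2 := by
        rw [mul_pow]
        exact mul_le_mul_of_nonneg_right (sq_le_sq.2 (hgR.trans (le_abs_self _))) (sq_nonneg _)
      have e1 : u i x + θ x * v i x - (d i + g * e i)
          = (u i x - d i) + (θ x - g) * v i x + g * (v i x - e i) := by ring
      rw [e1]
      nlinarith [sq_nonneg ((u i x - d i) - (θ x - g) * v i x),
        sq_nonneg ((u i x - d i) - g * (v i x - e i)),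
        sq_nonneg ((θ x - g) * v i x - g * (v i x - e i))]
    refine (Finset.sum_le_sum fun i _ => h3 i).trans ?_
    simp only [Finset.sum_add_distrib, ← Finset.mul_sum]
    have hβ0 : 0 ≤ ∑ i, β i ^ 2 := Finset.sum_nonneg fun i _ => sq_nonneg _
    have h4 : 9 * ((R / N) ^ 2 * ∑ i, β i ^ 2) ≤ n * ε ^ 2 := by
      have := pow_le_pow_left₀ (by positivity) hNR 2
      rw [mul_pow, mul_pow, mul_pow, Real.sq_sqrt hβ0, Real.sq_sqrt (Nat.cast_nonneg n)] at this
      linarith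
    have h5 : 9 * (R ^ 2 * ∑ i, (v i x - e i) ^ 2) ≤ n * ε ^ 2 := by
      have h6 := pow_le_pow_left₀ (by positivity) hρ 2
      have h7 := mul_le_mul_of_nonneg_left hev (sq_nonneg R)
      have h8 := mul_le_mul_of_nonneg_left h6 (Nat.cast_nonneg (α := ℝ) n)
      nlinarith
    nlinarith

/-! ### The upper bound -/

theorem CoordLipschitz.add {b₁ b₂ : Fin n → ℝ} {φ₁ φ₂ : (Fin n → ℝ) → ℝ}
    (h₁ : CoordLipschitz b₁ φ₁) (h₂ : CoordLipschitz b₂ φ₂) :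
    CoordLipschitz (fun i => b₁ i + b₂ i) (fun x => φ₁ x + φ₂ x) := by
  intro x hx y hy
  rw [add_sub_add_comm]
  refine (abs_add_le _ _).trans ((add_le_add (h₁ x hx y hy) (h₂ x hx y hy)).trans_eq ?_)
  simp only [add_mul, Finset.sum_add_distrib]

theorem CoordLipschitz.mul {b₁ b₂ : Fin n → ℝ} {φ₁ φ₂ : (Fin n → ℝ) → ℝ} {M₁ M₂ : ℝ}
    (h₁ : CoordLipschitz b₁ φ₁) (h₂ : CoordLipschitz b₂ φ₂)
    (hM₁ : ∀ x ∈ cube n, |φ₁ x| ≤ M₁) (hM₂ : ∀ x ∈ cube n, |φ₂ x| ≤ M₂) :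
    CoordLipschitz (fun i => M₁ * b₂ i + M₂ * b₁ i) (fun x => φ₁ x * φ₂ x) := by
  intro x hx y hy
  rw [show φ₁ x * φ₂ x - φ₁ y * φ₂ y = φ₁ x * (φ₂ x - φ₂ y) + φ₂ y * (φ₁ x - φ₁ y) by ring]
  refine (abs_add_le _ _).trans ?_
  rw [abs_mul, abs_mul]
  have e : ∑ i, (M₁ * b₂ i + M₂ * b₁ i) * |x i - y i|
      = M₁ * ∑ i, b₂ i * |x i - y i| + M₂ * ∑ i, b₁ i * |x i - y i| := by
    simp only [add_mul, Finset.sum_add_distrib, Finset.mul_sum, mul_assoc]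
  rw [e]
  exact add_le_add
    (mul_le_mul (hM₁ x hx) (h₂ x hx y hy) (abs_nonneg _) ((abs_nonneg _).trans (hM₁ x hx)))
    (mul_le_mul (hM₂ y hy) (h₁ x hx y hy) (abs_nonneg _) ((abs_nonneg _).trans (hM₂ y hy)))

theorem CoordLipschitz.mono {b b' : Fin n → ℝ} {φ : (Fin n → ℝ) → ℝ}
    (h : CoordLipschitz b φ) (hb : ∀ i, b i ≤ b' i) : CoordLipschitz b' φ :=
  fun x hx y hy => (h x hx y hy).trans
    (Finset.sum_le_sum fun i _ => mul_le_mul_of_nonneg_right (hb i) (abs_nonneg _))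

theorem CoordLipschitz.comp {b : Fin n → ℝ} {φ : (Fin n → ℝ) → ℝ} {g : ℝ → ℝ} {L : ℝ}
    (h : CoordLipschitz b φ) (hL : 0 ≤ L) (hg : ∀ u v, |g u - g v| ≤ L * |u - v|) :
    CoordLipschitz (fun i => L * b i) (fun x => g (φ x)) := by
  intro x hx y hy
  refine (hg _ _).trans ((mul_le_mul_of_nonneg_left (h x hx y hy) hL).trans_eq ?_)
  simp only [Finset.mul_sum, mul_assoc]

theorem HasGradient.add_comp {f h : (Fin n → ℝ) → ℝ} {f' h' : Fin n → (Fin n → ℝ) → ℝ}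
    {g g' : ℝ → ℝ} (hf : HasGradient f f') (hh : HasGradient h h')
    (hg : ∀ u, HasDerivAt g (g' u) u) :
    HasGradient (fun x => f x + g (h x)) (fun i x => f' i x + g' (h x) * h' i x) := by
  intro x hx
  have := (hf x hx).add ((hg (h x)).comp_hasFDerivWithinAt x (hh x hx))
  convert! this using 1
  simp only [add_smul, Finset.sum_add_distrib, Finset.smul_sum, mul_smul]

theorem norm₁_nonneg (f : (Fin n → ℝ) → ℝ) (i : Fin n) : 0 ≤ norm₁ f i := supNorm_nonneg _

theorem norm₂_nonneg (f : (Fin n → ℝ) → ℝ) (i j : Fin n) : 0 ≤ norm₂ f i j := supNorm_nonneg _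

theorem constK_pos (f : (Fin n → ℝ) → ℝ) : 0 < constK f := by
  have := supNorm_nonneg f
  have := Real.log_pos (one_lt_two)
  rw [constK]
  positivity

theorem constL_nonneg (f : (Fin n → ℝ) → ℝ) : 0 ≤ constL f := by
  have := supNorm_nonneg f
  have := constK_pos f
  rw [constL]
  positivity

theorem constM_nonneg (f h : (Fin n → ℝ) → ℝ) {δ : ℝ} (hδ : 0 < δ) (i : Fin n) :
    0 ≤ constM f h δ i := by
  have := norm₁_nonneg f i
  have := norm₁_nonneg h i
  have := constK_pos f
  rw [constM]
  positivity

theorem constN_nonneg (f h : (Fin n → ℝ) → ℝ) {δ : ℝ} (hδ : 0 < δ) (i j : Fin n) :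
    0 ≤ constN f h δ i j := by
  have := norm₂_nonneg f i j
  have := norm₂_nonneg h i j
  have := norm₁_nonneg h i
  have := norm₁_nonneg h j
  have := constK_pos f
  rw [constN]
  positivity

theorem neg_entropyI_le {x : Fin n → ℝ} : -entropyI x ≤ n * Real.log 2 := by
  have : ∑ _i : Fin n, -Real.log 2 ≤ entropyI x :=
    Finset.sum_le_sum fun i _ => neg_log_two_le_mul_log_add_mul_log (x i)
  simp at this
  linarith

theorem entropyI_of_mem_vertices {x : Fin n → ℝ} (hx : x ∈ vertices n) : entropyI x = 0 := by
  refine Finset.sum_eq_zero fun i _ => ?_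
  rcases mem_vertices.1 hx i with h | h <;> simp [h]

section Upper

variable {f h : (Fin n → ℝ) → ℝ} {Df Dh : ℝ → Finset (Fin n → ℝ)} {t δ ε : ℝ}

theorem exists_cover_penalised (hn : 0 < n) (hh : ContDiffOn ℝ 2 h (cube n))
    (hDf : IsGradientCover f Df) (hDh : IsGradientCover h Dh) (hδ : 0 < δ) (hε : 0 < ε)
    {θ : (Fin n → ℝ) → ℝ} (hθ : ∀ x ∈ cube n, |θ x| ≤ 2 * constK f / δ) :
    ∃ D : Finset (Fin n → ℝ),
      Real.log D.card ≤
        Real.log (max 1 (12 * constK f * √(1 / n * ∑ i, norm₁ h i ^ 2) / (δ * ε)))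
        + Real.log (Df (ε / 3)).card + Real.log (Dh (δ * ε / (6 * constK f))).card ∧
      ∀ x ∈ cube n, ∃ d ∈ D, ∑ i, (pd i f x + θ x * pd i h x - d i) ^ 2 ≤ n * ε ^ 2 := by
  have hK := constK_pos f
  have hn' : (0 : ℝ) < n := Nat.cast_pos.2 hn
  set K := constK f
  set T := ∑ i, norm₁ h i ^ 2
  -- The threshold is the least value of `N` for which the grid on `[-2K/δ, 2K/δ]` contributes at
  -- most `√n ε / 3`.
  obtain ⟨N, hN, hqN, hNq⟩ := exists_nat_ge_le_max (6 * K * √(1 / n * T) / (δ * ε))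
  have hN' : (0 : ℝ) < N := Nat.cast_pos.2 hN
  have hT : √(1 / n * T) = √T / √n := by
    rw [one_div_mul_eq_div, Real.sqrt_div' _ hn'.le]
  have hsn : 0 < √(n : ℝ) := Real.sqrt_pos.2 hn'
  obtain ⟨D, hDcard, hD⟩ := exists_cover_add_mul (s := cube n) (u := fun i => pd i f)
    (v := fun i => pd i h) (θ := θ) (β := norm₁ h) (R := 2 * K / δ) (ε := ε)
    (ρ := δ * ε / (6 * K)) hN (by positivity)
    (le_of_eq (by field_simp; norm_num)) (by positivity) hθ (fun i x hx => abs_pd_le hh i hx)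
    (by
      rw [hT, div_le_iff₀ (by positivity), mul_div_assoc', div_le_iff₀ hsn] at hqN
      rw [show 3 * (2 * K / δ / N * √T) = 6 * K * √T / (δ * N) by field_simp; ring,
        div_le_iff₀ (by positivity)]
      linarith)
    (hDf (ε / 3) (by positivity)) (hDh (δ * ε / (6 * K)) (by positivity))
  refine ⟨D, ?_, hD⟩
  have h0 : (0 : Fin n → ℝ) ∈ cube n := mem_cube.2 fun _ => by simp
  have cD : (0 : ℝ) < D.card := by
    obtain ⟨d, hd, -⟩ := hD 0 h0
    exact_mod_cast Finset.card_pos.2 ⟨d, hd⟩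
  have cA : (0 : ℝ) < (Df (ε / 3)).card := by
    obtain ⟨d, hd, -⟩ := hDf (ε / 3) (by positivity) 0 h0
    exact_mod_cast Finset.card_pos.2 ⟨d, hd⟩
  have cB : (0 : ℝ) < (Dh (δ * ε / (6 * K))).card := by
    obtain ⟨d, hd, -⟩ := hDh (δ * ε / (6 * K)) (by positivity) 0 h0
    exact_mod_cast Finset.card_pos.2 ⟨d, hd⟩
  have h1 : (D.card : ℝ) ≤ N * ((Df (ε / 3)).card * (Dh (δ * ε / (6 * K))).card) := by
    exact_mod_cast hDcard
  have h2 := Real.log_le_log cD h1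
  rw [Real.log_mul hN'.ne' (by positivity), Real.log_mul cA.ne' cB.ne'] at h2
  have h3 := Real.log_le_log hN' hNq
  rw [show 2 * (6 * K * √(1 / n * T) / (δ * ε)) = 12 * K * √(1 / n * T) / (δ * ε) by ring] at h3
  linarith

/-- Under the outer root only the terms `l n_ij²` are needed; the others are nonnegative and are
discarded, as is `log 2`. -/
theorem sqrt_constL_mul_le_smoothnessTerm (hδ : 0 < δ) :
    √(constL f * ∑ i, ∑ j, constN f h δ i j ^ 2)
      + 1 / 4 * √(∑ i, constM f h δ i ^ 2) * √(∑ i, constN f h δ i i ^ 2)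
      + 3 * ∑ i, constN f h δ i i ≤ smoothnessTerm f h δ := by
  have hl := constL_nonneg f
  have hm := constM_nonneg f h hδ
  have hN := constN_nonneg f h hδ
  have hlog := Real.log_pos (one_lt_two)
  rw [smoothnessTerm]
  set A := ∑ i, (constL f * constN f h δ i i + constM f h δ i ^ 2) with hA
  have hA0 : 0 ≤ A := Finset.sum_nonneg fun i _ =>
    add_nonneg (mul_nonneg hl (hN i i)) (sq_nonneg _)
  have hB : constL f * ∑ i, ∑ j, constN f h δ i j ^ 2
      ≤ ∑ i, ∑ j, (constL f * constN f h δ i j ^ 2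
          + constM f h δ i * constM f h δ j * constN f h δ i j
          + 4 * constM f h δ i * constN f h δ i j) := by
    simp only [Finset.mul_sum]
    refine Finset.sum_le_sum fun i _ => Finset.sum_le_sum fun j _ => ?_
    have h1 := mul_nonneg (mul_nonneg (hm i) (hm j)) (hN i j)
    have h2 := mul_nonneg (hm i) (hN i j)
    linarith
  have h0 : 0 ≤ constL f * ∑ i, ∑ j, constN f h δ i j ^ 2 :=
    mul_nonneg hl (Finset.sum_nonneg fun i _ => Finset.sum_nonneg fun j _ => sq_nonneg _)
  set B := ∑ i, ∑ j, (constL f * constN f h δ i j ^ 2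
          + constM f h δ i * constM f h δ j * constN f h δ i j
          + 4 * constM f h δ i * constN f h δ i j)
  have : √(constL f * ∑ i, ∑ j, constN f h δ i j ^ 2) ≤ 4 * √(A + 1 / 4 * B) := by
    refine Real.sqrt_le_iff.2 ⟨by positivity, ?_⟩
    rw [mul_pow, Real.sq_sqrt (by linarith)]
    linarith
  linarith

theorem log_sum_exp_penalised_le (hn : 0 < n) (hf : ContDiffOn ℝ 2 f (cube n))
    (hh : ContDiffOn ℝ 2 h (cube n)) (hDf : IsGradientCover f Df) (hDh : IsGradientCover h Dh)
    (ht : 0 < t) (hδ : 0 < δ) (hε : 0 < ε) {M : ℝ} (hM0 : -supNorm f ≤ M)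
    (hM : ∀ x ∈ cube n, |h x| ≤ (t + δ) * n → f x - entropyI x ≤ M) :
    Real.log (∑ x ∈ vertices n,
        Real.exp (f x + -(n * constK f) * penalty (t * n) (δ * n) (h x)))
      ≤ M + (complexityTerm f h Df Dh δ ε + smoothnessTerm f h δ) := by
  have hK := constK_pos f
  have hn' : (0 : ℝ) < n := Nat.cast_pos.2 hn
  set K := constK f with hKdef
  have hw : 0 < δ * n := by positivity
  have hr : 0 ≤ t * n := by positivity
  have hnK : 0 ≤ n * K := by positivity
  set θ : ℝ → ℝ := fun u => -(n * K) * penaltyDeriv (t * n) (δ * n) u with hθ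
  have hθb : ∀ u, |θ u| ≤ 2 * K / δ := fun u => by
    rw [hθ, abs_mul, abs_neg, abs_of_nonneg hnK]
    refine (mul_le_mul_of_nonneg_left (abs_penaltyDeriv_le hw u) hnK).trans_eq ?_
    field_simp
  have hθL : ∀ u v, |θ u - θ v| ≤ 4 * K / (n * δ ^ 2) * |u - v| := fun u v => by
    rw [hθ, ← mul_sub, abs_mul, abs_neg, abs_of_nonneg hnK]
    refine (mul_le_mul_of_nonneg_left (abs_penaltyDeriv_sub_le hr hw u v) hnK).trans_eq ?_
    field_simp
  obtain ⟨D, hDcard, hD⟩ := exists_cover_penalised hn hh hDf hDh hδ hε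
    (θ := fun x => θ (h x)) (fun x _ => hθb (h x))
  have hgrad : HasGradient (fun x => f x + -(n * K) * penalty (t * n) (δ * n) (h x))
      (fun i x => pd i f x + θ (h x) * pd i h x) :=
    (hasGradient_pd (hf.differentiableOn (by norm_num))).add_comp
      (hasGradient_pd (hh.differentiableOn (by norm_num)))
      (g := fun u => -(n * K) * penalty (t * n) (δ * n) u)
      (fun u => (hasDerivAt_penalty _ _ u).const_mul _)
  have key := log_sum_exp_le (b := constM f h δ) (c := constN f h δ) (a := constL f) hgrad
    (fun x hx => by
      have h1 := abs_le_supNorm hf.continuousOn hx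
      refine (abs_add_le _ _).trans (add_le_add h1 ?_)
      rw [abs_mul, abs_neg, abs_of_nonneg hnK, abs_of_nonneg (penalty_nonneg _ _ _)]
      exact mul_le_of_le_one_right hnK (penalty_le_one hr hw _))
    (fun i x hx => by
      refine (abs_add_le _ _).trans (add_le_add (abs_pd_le hf i hx) ?_)
      rw [abs_mul]
      refine (mul_le_mul (hθb _) (abs_pd_le hh i hx) (abs_nonneg _) (by positivity)).trans_eq ?_
      ring)
    (fun j => by
      refine ((coordLipschitz_pd hf j).add
        (((coordLipschitz_norm₁ hh).comp (by positivity) hθL).mul (coordLipschitz_pd hh j)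
          (fun x _ => hθb (h x)) (fun x hx => abs_pd_le hh j hx))).mono fun i => ?_
      -- The slope of `tent` gives the constant `4`, below the `6` in `n_ij`.
      have h1 : 4 * K / (n * δ ^ 2) * (norm₁ h i * norm₁ h j)
          ≤ 6 * K / (n * δ ^ 2) * (norm₁ h i * norm₁ h j) := by
        refine mul_le_mul_of_nonneg_right ?_ (mul_nonneg (norm₁_nonneg _ _) (norm₁_nonneg _ _))
        gcongr
        norm_num
      rw [constN, ← hKdef]
      calc _ = norm₂ f i j + 2 * K * norm₂ h i j / δ
            + 4 * K / (n * δ ^ 2) * (norm₁ h i * norm₁ h j) := by ring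
        _ ≤ norm₂ f i j + 2 * K * norm₂ h i j / δ
            + 6 * K / (n * δ ^ 2) * (norm₁ h i * norm₁ h j) := by linarith
        _ = _ := by ring)
    (constN_nonneg f h hδ) hε.le hD (M := M) (fun x hx => by
      rcases le_total |h x| ((t + δ) * n) with hxh | hxh
      · have h1 := hM x hx hxh
        have h2 := mul_nonneg hnK (penalty_nonneg (t * n) (δ * n) (h x))
        linarith
      -- Here the penalty costs `nK = n log 2 + 2a`, while `f - I ≤ a + n log 2`, leaving at most
      -- `-a ≤ M`.
      · rw [penalty_eq_one hr hw (by linarith)]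
        have h1 := (abs_le.1 (abs_le_supNorm hf.continuousOn hx)).2
        have h2 := neg_entropyI_le (x := x)
        have h3 : n * K = n * Real.log 2 + 2 * supNorm f := by
          rw [hKdef, constK]
          field_simp
        linarith)
  have hsmooth := sqrt_constL_mul_le_smoothnessTerm (f := f) (h := h) hδ
  have hnε : 0 ≤ n * ε := by positivity
  refine key.trans ?_
  rw [complexityTerm, ← hKdef]
  linarith

theorem condLogSum_le (hn : 0 < n) (hf : ContDiffOn ℝ 2 f (cube n))
    (hh : ContDiffOn ℝ 2 h (cube n)) (hDf : IsGradientCover f Df) (hDh : IsGradientCover h Dh)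
    (ht : 0 < t) (hδ : 0 < δ) (hε : 0 < ε) :
    condLogSum f h t ≤ constrainedSup f h (t + δ)
      + ((complexityTerm f h Df Dh δ ε + smoothnessTerm f h δ : ℝ) : EReal) := by
  have hn' : (0 : ℝ) < n := Nat.cast_pos.2 hn
  rw [condLogSum]
  set V := (vertices n).filter fun x => |h x| ≤ t * n with hV
  rcases V.eq_empty_or_nonempty with hVe | ⟨x₀, hx₀⟩
  · simp [hVe]
  have hS : 0 < ∑ x ∈ V, Real.exp (f x) :=
    Finset.sum_pos (fun x _ => Real.exp_pos _) ⟨x₀, hx₀⟩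
  rw [ENNReal.log_ofReal_of_pos hS]
  obtain ⟨hv₀, hh₀⟩ := Finset.mem_filter.1 hx₀
  have hle : ∀ x ∈ cube n, |h x| ≤ (t + δ) * n →
      ((f x - entropyI x : ℝ) : EReal) ≤ constrainedSup f h (t + δ) := fun x hx hxh =>
    le_iSup₂ (f := fun x (_ : x ∈ {x ∈ cube n | |h x| ≤ (t + δ) * n}) =>
      ((f x - entropyI x : ℝ) : EReal)) x ⟨hx, hxh⟩
  have h₀ := hle x₀ (vertices_subset_cube hv₀) (hh₀.trans (by gcongr; linarith))
  have hub : constrainedSup f h (t + δ) ≤ ((supNorm f + n * Real.log 2 : ℝ) : EReal) :=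
    iSup₂_le fun x hx => by
      have h1 := (abs_le.1 (abs_le_supNorm hf.continuousOn hx.1)).2
      have h2 := neg_entropyI_le (x := x)
      exact_mod_cast (by linarith : f x - entropyI x ≤ supNorm f + n * Real.log 2)
  lift constrainedSup f h (t + δ) to ℝ using
    ⟨ne_top_of_le_ne_top (EReal.coe_ne_top _) hub, ne_bot_of_le_ne_bot (EReal.coe_ne_bot _) h₀⟩
    with M
  -- A feasible vertex exists, and `I` vanishes at vertices.
  have hM0 : -supNorm f ≤ M := by
    have h1 := (abs_le.1 (abs_le_supNorm hf.continuousOn (vertices_subset_cube hv₀))).1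
    have h2 : f x₀ - entropyI x₀ ≤ M := by exact_mod_cast h₀
    rw [entropyI_of_mem_vertices hv₀] at h2
    linarith
  have key := log_sum_exp_penalised_le hn hf hh hDf hDh ht hδ hε hM0
    (fun x hx hxh => by exact_mod_cast hle x hx hxh)
  -- The penalty is zero on the constrained vertices, and the remaining terms are positive.
  have hmono : Real.log (∑ x ∈ V, Real.exp (f x)) ≤ Real.log (∑ x ∈ vertices n,
      Real.exp (f x + -(n * constK f) * penalty (t * n) (δ * n) (h x))) := by
    refine Real.log_le_log hS ?_
    calc _ = ∑ x ∈ V, Real.exp (f x + -(n * constK f) * penalty (t * n) (δ * n) (h x)) :=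
          Finset.sum_congr rfl fun x hx => by
            rw [penalty_eq_zero (by positivity) (by positivity) (Finset.mem_filter.1 hx).2,
              mul_zero, add_zero]
      _ ≤ _ := Finset.sum_le_sum_of_subset_of_nonneg (Finset.filter_subset _ _)
          fun x _ _ => (Real.exp_pos _).le
  exact_mod_cast hmono.trans key

end Upper


/-! ### The lower bound -/

/-- The law of independent Bernoulli variables with means `y`. -/
noncomputable def bernoulliWeight (y x : Fin n → ℝ) : ℝ :=
  ∏ i, (x i * y i + (1 - x i) * (1 - y i))

theorem bernoulliWeight_nonneg {y x : Fin n → ℝ} (hy : y ∈ cube n) (hx : x ∈ cube n) :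
    0 ≤ bernoulliWeight y x := by
  refine Finset.prod_nonneg fun i _ => ?_
  have a := mem_cube.1 hy i
  have b := mem_cube.1 hx i
  exact add_nonneg (mul_nonneg b.1 a.1) (mul_nonneg (by linarith) (by linarith))

theorem sum_bernoulliWeight (y : Fin n → ℝ) : ∑ x ∈ vertices n, bernoulliWeight y x = 1 := by
  simp only [bernoulliWeight]
  rw [sum_vertices_prod fun i s => s * y i + (1 - s) * (1 - y i)]
  exact Finset.prod_eq_one fun i _ => by ring

theorem bernoulliWeight_update (y x : Fin n → ℝ) (i : Fin n) (s : ℝ) :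
    bernoulliWeight y (Function.update x i s) = (s * y i + (1 - s) * (1 - y i))
      * ∏ j ∈ Finset.univ.erase i, (x j * y j + (1 - x j) * (1 - y j)) := by
  rw [bernoulliWeight, ← Finset.mul_prod_erase _ _ (Finset.mem_univ i), Function.update_self]
  congr 1
  refine Finset.prod_congr rfl fun j hj => ?_
  rw [Function.update_of_ne (Finset.ne_of_mem_erase hj)]

theorem bernoulliWeight_update_one (y x : Fin n → ℝ) (i : Fin n) :
    bernoulliWeight y (Function.update x i 1) = y i
      * (bernoulliWeight y (Function.update x i 0) + bernoulliWeight y (Function.update x i 1)) := by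
  rw [bernoulliWeight_update, bernoulliWeight_update]
  ring

/-- The centred log-likelihood of `x` under independent Bernoulli variables with means `y`. -/
noncomputable def centredLogLikelihood (y x : Fin n → ℝ) : ℝ :=
  ∑ i, (x i - y i) * (Real.log (y i) - Real.log (1 - y i))

/-- In each factor the terms combine formally to the single logarithm selected by `xᵢ`, whose
argument is positive since the weight is nonzero. Coordinates with `yᵢ ∈ {0, 1}` are therefore
covered, whatever value `log 0` takes. -/
theorem bernoulliWeight_eq_exp {y x : Fin n → ℝ} (hy : y ∈ cube n) (hx : x ∈ vertices n)
    (h : bernoulliWeight y x ≠ 0) :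
    bernoulliWeight y x = Real.exp (entropyI y + centredLogLikelihood y x) := by
  rw [entropyI, centredLogLikelihood, ← Finset.sum_add_distrib, Real.exp_sum]
  refine Finset.prod_congr rfl fun i hi => ?_
  have h1 := Finset.prod_ne_zero_iff.1 h i hi
  have h2 := mem_cube.1 hy i
  rcases mem_vertices.1 hx i with h0 | h0
  · simp only [h0, zero_mul, zero_add, sub_zero, one_mul] at h1 ⊢
    rw [show y i * Real.log (y i) + (1 - y i) * Real.log (1 - y i)
      + (0 - y i) * (Real.log (y i) - Real.log (1 - y i)) = Real.log (1 - y i) by ring,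
      Real.exp_log (lt_of_le_of_ne (by linarith) h1.symm)]
  · simp only [h0, one_mul, sub_self, zero_mul, add_zero] at h1 ⊢
    rw [show y i * Real.log (y i) + (1 - y i) * Real.log (1 - y i)
      + (1 - y i) * (Real.log (y i) - Real.log (1 - y i)) = Real.log (y i) by ring,
      Real.exp_log (lt_of_le_of_ne h2.1 h1.symm)]

/-- Expanding one factor of the square gives terms `(xᵢ - yᵢ) λᵢ U`. Resampling bounds each by `yᵢ
(1 - yᵢ) λᵢ² ≤ 4`. -/
theorem sum_bernoulliWeight_mul_centredLogLikelihood_sq_le {y : Fin n → ℝ} (hy : y ∈ cube n) :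
    ∑ x ∈ vertices n, bernoulliWeight y x * centredLogLikelihood y x ^ 2 ≤ 4 * n := by
  set U := centredLogLikelihood y with hU
  set lam : Fin n → ℝ := fun i => Real.log (y i) - Real.log (1 - y i) with hlam
  have hUd : ∀ x : Fin n → ℝ, ∀ i,
      U (Function.update x i 1) - U (Function.update x i 0) = lam i := by
    intro x i
    simp only [hU, centredLogLikelihood]
    rw [← Finset.sum_sub_distrib, Finset.sum_eq_single i (fun j _ hj => by simp [hj]) (by simp)]
    simp [hlam]
    ring
  have e : ∑ x ∈ vertices n, bernoulliWeight y x * U x ^ 2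
      = ∑ i, ∑ x ∈ vertices n, bernoulliWeight y x * ((x i - y i) * (lam i * U x)) := by
    rw [Finset.sum_comm]
    refine Finset.sum_congr rfl fun x _ => ?_
    rw [← Finset.mul_sum, pow_two]
    nth_rewrite 1 [hU]
    rw [centredLogLikelihood, Finset.sum_mul]
    congr 1
    exact Finset.sum_congr rfl fun i _ => by rw [hlam]; ring
  rw [e]
  have h : ∀ i, ∑ x ∈ vertices n, bernoulliWeight y x * ((x i - y i) * (lam i * U x)) ≤ 4 := by
    intro i
    have hyi := mem_cube.1 hy i
    have := abs_sum_weight_sub_mul_le (W := bernoulliWeight y) (p := fun _ => y i)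
      (w := fun x => lam i * U x) (M := 4) i
      (fun x hx => bernoulliWeight_nonneg hy (vertices_subset_cube hx)) (fun _ _ _ => rfl)
      (fun x _ => bernoulliWeight_update_one y x i) (fun x _ => by
        rw [← mul_sub, hUd, ← pow_two, abs_of_nonneg (mul_nonneg (mul_nonneg hyi.1
          (by linarith)) (sq_nonneg _))]
        exact mul_one_sub_mul_sq_log_sub_le hyi.1 hyi.2)
    rw [sum_bernoulliWeight, mul_one] at this
    exact (le_abs_self _).trans this
  refine (Finset.sum_le_sum fun i _ => h i).trans_eq ?_
  simp [mul_comm]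

/-- One factor `f x - f y` of the square serves as the multiplier `v`, the other is interpolated. A
flip of `xᵢ` then changes `v · f_i` by at most `2a c_ii + b_i²`. -/
theorem sum_bernoulliWeight_mul_sub_sq_le {f : (Fin n → ℝ) → ℝ}
    (hf : ContDiffOn ℝ 2 f (cube n)) {y : Fin n → ℝ} (hy : y ∈ cube n) :
    ∑ x ∈ vertices n, bernoulliWeight y x * (f x - f y) ^ 2
      ≤ ∑ i, (supNorm f * norm₂ f i i + norm₁ f i ^ 2) := by
  have ha : ∀ x ∈ cube n, |f x| ≤ supNorm f := fun x hx => abs_le_supNorm hf.continuousOn hx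
  have ha0 := supNorm_nonneg f
  have h := abs_sum_weight_mul_sub_le (hasGradient_pd (hf.differentiableOn (by norm_num)))
    (W := bernoulliWeight y) (v := fun x => f x - f y) (q := fun _ => y)
    (M := fun i => 2 * supNorm f * norm₂ f i i + norm₁ f i ^ 2)
    (fun x hx => bernoulliWeight_nonneg hy (vertices_subset_cube hx)) (fun _ _ => hy)
    (fun _ _ _ _ => rfl) (fun x _ i => bernoulliWeight_update_one y x i)
    (fun s hs i x₀ h₀ x₁ h₁ hx => by
      have c₀ := vertices_subset_cube h₀
      have c₁ := vertices_subset_cube h₁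
      have z₀ := lineMap_mem_cube c₀ hy hs
      have z₁ := lineMap_mem_cube c₁ hy hs
      have hx1 : |x₁ i - x₀ i| ≤ 1 := by
        have a := mem_cube.1 c₁ i
        have b := mem_cube.1 c₀ i
        rw [abs_le]
        constructor <;> linarith [a.1, a.2, b.1, b.2]
      have hz1 : |(y + s • (x₁ - y)) i - (y + s • (x₀ - y)) i| ≤ 1 := by
        have a := mem_cube.1 z₁ i
        have b := mem_cube.1 z₀ i
        rw [abs_le]
        constructor <;> linarith [a.1, a.2, b.1, b.2]
      have b1 : |pd i f (y + s • (x₁ - y)) - pd i f (y + s • (x₀ - y))| ≤ norm₂ f i i :=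
        ((coordLipschitz_pd hf i).abs_sub_le_of_eq_off z₁ z₀ i
          (fun j hj => by simp [hx j hj])).trans
          (mul_le_of_le_one_right (norm₂_nonneg f i i) hz1)
      have b2 : |f x₁ - f x₀| ≤ norm₁ f i :=
        ((coordLipschitz_norm₁ hf).abs_sub_le_of_eq_off c₁ c₀ i hx).trans
          (mul_le_of_le_one_right (norm₁_nonneg f i) hx1)
      have b3 : |f x₁ - f y| ≤ 2 * supNorm f := by
        have := abs_sub (f x₁) (f y)
        have := ha _ c₁
        have := ha _ hy
        linarith
      rw [show (f x₁ - f y) * pd i f (y + s • (x₁ - y)) - (f x₀ - f y) * pd i f (y + s • (x₀ - y))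
        = (f x₁ - f y) * (pd i f (y + s • (x₁ - y)) - pd i f (y + s • (x₀ - y)))
          + pd i f (y + s • (x₀ - y)) * (f x₁ - f x₀) by ring]
      refine (abs_add_le _ _).trans ?_
      rw [abs_mul, abs_mul, pow_two]
      exact add_le_add (mul_le_mul b3 b1 (abs_nonneg _) (by positivity))
        (mul_le_mul (abs_pd_le hf i z₀) b2 (abs_nonneg _) (norm₁_nonneg f i)))
  rw [sum_bernoulliWeight, mul_one, Finset.mul_sum] at h
  have e : ∑ x ∈ vertices n, bernoulliWeight y x * (f x - f y) ^ 2
      = ∑ x ∈ vertices n, bernoulliWeight y x * ((f x - f y) * (f x - f y)) := by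
    simp only [pow_two]
  rw [e]
  refine (le_abs_self _).trans (h.trans (Finset.sum_le_sum fun i _ => ?_))
  have h1 := mul_nonneg ha0 (norm₂_nonneg f i i)
  have h2 := sq_nonneg (norm₁ f i)
  linarith

/-- Chebyshev's inequality for a finite weight. -/
theorem six_mul_sum_filter_lt_abs_le {α : Type*} {s : Finset α} {W U : α → ℝ} {r : ℝ}
    (hr : 0 ≤ r) (hW : ∀ x ∈ s, 0 ≤ W x) (hU : 6 * ∑ x ∈ s, W x * U x ^ 2 ≤ r ^ 2) :
    6 * ∑ x ∈ s with r < |U x|, W x ≤ 1 := by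
  have hpos : ∀ x ∈ s, 0 ≤ W x * U x ^ 2 := fun x hx => mul_nonneg (hW x hx) (sq_nonneg _)
  rcases hr.eq_or_lt with rfl | hr
  -- For `r = 0` one cannot divide by `r²`, but the second moment vanishes, so the weight is zero
  -- wherever `U` is not.
  · have h0 : ∑ x ∈ s, W x * U x ^ 2 = 0 :=
      le_antisymm (by linarith) (Finset.sum_nonneg hpos)
    rw [Finset.sum_eq_zero fun x hx => ?_]
    · norm_num
    · obtain ⟨hxs, hx⟩ := Finset.mem_filter.1 hx
      exact (mul_eq_zero.1 ((Finset.sum_eq_zero_iff_of_nonneg hpos).1 h0 x hxs)).resolve_right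
        (pow_ne_zero 2 (abs_pos.1 hx))
  · have h1 : ∑ x ∈ s with r < |U x|, W x * r ^ 2 ≤ ∑ x ∈ s, W x * U x ^ 2 :=
      (Finset.sum_le_sum fun x hx => by
        obtain ⟨hxs, hx⟩ := Finset.mem_filter.1 hx
        refine mul_le_mul_of_nonneg_left ?_ (hW x hxs)
        rw [← sq_abs (U x)]
        exact pow_le_pow_left₀ hr.le hx.le 2).trans
        (Finset.sum_le_sum_of_subset_of_nonneg (Finset.filter_subset _ _)
          fun x hx _ => hpos x hx)
    rw [← Finset.sum_mul] at h1
    have hr2 : 0 < r ^ 2 := by positivity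
    nlinarith

theorem deviation_mul (hn : 0 < n) (f : (Fin n → ℝ) → ℝ) :
    0 ≤ deviation f * n ∧
      (deviation f * n) ^ 2 = 6 * ∑ i, (supNorm f * norm₂ f i i + norm₁ f i ^ 2) := by
  have hn' : (0 : ℝ) < n := Nat.cast_pos.2 hn
  have h0 : 0 ≤ ∑ i, (supNorm f * norm₂ f i i + norm₁ f i ^ 2) :=
    Finset.sum_nonneg fun i _ =>
      add_nonneg (mul_nonneg (supNorm_nonneg f) (norm₂_nonneg f i i)) (sq_nonneg _)
  have e : deviation f * n = √6 * √(∑ i, (supNorm f * norm₂ f i i + norm₁ f i ^ 2)) := by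
    rw [deviation]
    field_simp
  rw [e, mul_pow, Real.sq_sqrt h0, Real.sq_sqrt (by norm_num)]
  exact ⟨by positivity, rfl⟩

theorem half_exp_le_sum_exp (hn : 0 < n) {f h : (Fin n → ℝ) → ℝ}
    (hf : ContDiffOn ℝ 2 f (cube n)) (hh : ContDiffOn ℝ 2 h (cube n)) {t : ℝ} {y : Fin n → ℝ}
    (hy : y ∈ cube n) (hhy : |h y| ≤ (t - deviation h) * n) :
    1 / 2 * Real.exp (f y - entropyI y - (2 * √(6 / n) * n + deviation f * n))
      ≤ ∑ x ∈ vertices n with |h x| ≤ t * n, Real.exp (f x) := by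
  classical
  have hn' : (0 : ℝ) < n := Nat.cast_pos.2 hn
  set W := bernoulliWeight y with hWdef
  set U := centredLogLikelihood y with hUdef
  set r := 2 * √(6 / n) * n with hr
  have hW : ∀ x ∈ vertices n, 0 ≤ W x := fun x hx =>
    bernoulliWeight_nonneg hy (vertices_subset_cube hx)
  have hr2 : r ^ 2 = 6 * (4 * n) := by
    rw [hr, mul_pow, mul_pow, Real.sq_sqrt (by positivity)]
    field_simp
    norm_num
  obtain ⟨df0, df⟩ := deviation_mul hn f
  obtain ⟨dh0, dh⟩ := deviation_mul hn h
  have c1 := six_mul_sum_filter_lt_abs_le (s := vertices n) (W := W) (U := fun x => f x - f y)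
    df0 hW (by rw [df]; linarith [sum_bernoulliWeight_mul_sub_sq_le hf hy])
  have c2 := six_mul_sum_filter_lt_abs_le (s := vertices n) (W := W) (U := fun x => h x - h y)
    dh0 hW (by rw [dh]; linarith [sum_bernoulliWeight_mul_sub_sq_le hh hy])
  have c3 := six_mul_sum_filter_lt_abs_le (s := vertices n) (W := W) (U := U) (r := r)
    (by positivity) hW
    (by rw [hr2]; linarith [sum_bernoulliWeight_mul_centredLogLikelihood_sq_le hy])
  set A := (vertices n).filter fun x =>
    |f x - f y| ≤ deviation f * n ∧ |h x - h y| ≤ deviation h * n ∧ |U x| ≤ r with hA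
  -- Union bound: three exceptional events of probability at most `1/6` each.
  have hAW : 1 / 2 ≤ ∑ x ∈ A, W x := by
    have h1 : ∑ x ∈ vertices n, W x ≤ ∑ x ∈ A, W x
        + (∑ x ∈ vertices n with deviation f * n < |f x - f y|, W x
          + (∑ x ∈ vertices n with deviation h * n < |h x - h y|, W x
            + ∑ x ∈ vertices n with r < |U x|, W x)) := by
      simp only [hA, Finset.sum_filter, ← Finset.sum_add_distrib]
      refine Finset.sum_le_sum fun x hx => ?_
      have := hW x hx
      split_ifs <;> first | linarith | (exfalso; grind)
    rw [hWdef, sum_bernoulliWeight, ← hWdef] at h1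
    linarith
  calc _ ≤ (∑ x ∈ A, W x) * Real.exp (f y - entropyI y - (r + deviation f * n)) :=
        mul_le_mul_of_nonneg_right hAW (Real.exp_pos _).le
    _ ≤ ∑ x ∈ A, Real.exp (f x) := by
        rw [Finset.sum_mul]
        refine Finset.sum_le_sum fun x hx => ?_
        obtain ⟨hxv, h1, -, h3⟩ := Finset.mem_filter.1 hx
        by_cases h0 : W x = 0
        · rw [h0, zero_mul]
          exact (Real.exp_pos _).le
        · rw [hWdef, bernoulliWeight_eq_exp hy hxv h0, ← Real.exp_add]
          refine Real.exp_le_exp.2 ?_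
          have a := (abs_le.1 h1).1
          have b := (abs_le.1 h3).2
          rw [← hUdef]
          linarith
    _ ≤ _ := by
        refine Finset.sum_le_sum_of_subset_of_nonneg (fun x hx => ?_)
          fun x _ _ => (Real.exp_pos _).le
        obtain ⟨hxv, -, h2, -⟩ := Finset.mem_filter.1 hx
        refine Finset.mem_filter.2 ⟨hxv, ?_⟩
        have := abs_sub_abs_le_abs_sub (h x) (h y)
        linarith

theorem le_condLogSum (hn : 0 < n) {f h : (Fin n → ℝ) → ℝ}
    (hf : ContDiffOn ℝ 2 f (cube n)) (hh : ContDiffOn ℝ 2 h (cube n)) (t : ℝ) :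
    constrainedSup f h (t - deviation h)
        - ((2 * √(6 / n) * n + deviation f * n + Real.log 2 : ℝ) : EReal)
      ≤ condLogSum f h t := by
  refine EReal.sub_le_of_le_add (iSup₂_le fun y hy => ?_)
  have key := half_exp_le_sum_exp hn hf hh hy.1 hy.2
  have hpos : 0 < 1 / 2 * Real.exp (f y - entropyI y - (2 * √(6 / n) * n + deviation f * n)) := by
    positivity
  rw [condLogSum, ENNReal.log_ofReal_of_pos (hpos.trans_le key), ← EReal.coe_add,
    EReal.coe_le_coe_iff]
  have h1 := Real.log_le_log hpos key
  rw [Real.log_mul (by norm_num) (Real.exp_pos _).ne', Real.log_exp, one_div, Real.log_inv] at h1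
  linarith

end CondNorm

theorem mainTheorem1 (n : ℕ) (hn : 0 < n) (f h : (Fin n → ℝ) → ℝ)
    (hf : ContDiffOn ℝ 2 f (CondNorm.cube n)) (hh : ContDiffOn ℝ 2 h (CondNorm.cube n))
    (Df Dh : ℝ → Finset (Fin n → ℝ))
    (hDf : CondNorm.IsGradientCover f Df) (hDh : CondNorm.IsGradientCover h Dh)
    (t : ℝ) (ht : 0 < t) :
    (∀ δ ε : ℝ, 0 < δ → 0 < ε →
      CondNorm.condLogSum f h t ≤ CondNorm.constrainedSup f h (t + δ)
        + ((CondNorm.complexityTerm f h Df Dh δ ε + CondNorm.smoothnessTerm f h δ : ℝ) : EReal)) ∧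
    CondNorm.constrainedSup f h (t - CondNorm.deviation h)
        - ((2 * √(6 / n) * n + CondNorm.deviation f * n + Real.log 2 : ℝ) : EReal)
      ≤ CondNorm.condLogSum f h t :=
  ⟨fun _ _ hδ hε => CondNorm.condLogSum_le hn hf hh hDf hDh ht hδ hε,
    CondNorm.le_condLogSum hn hf hh t⟩
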